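/- For integers $k,\ell\ge 0$ let $\mathbb{C}\langle X_1,\ldots,X_k,Y_1,\ldots,Y_\ell\rangle$ denote the algebra of non-commutative polynomials, and let $\operatorname{tr}_N=\frac1N\operatorname{Tr}$. For a tuple $\mathbf{M}$ of $N\times N$ complex matrices, let $\tau_{\mathbf{M}}(P)=\operatorname{tr}_N(P(\mathbf{M}))$ be its non-commutative distribution. A sequence $(\mathbf{M}_N)_{N\ge1}$ of tuples of $N\times N$ matrices is bounded in non-commutative distribution if $\sup_{N\ge1}|\tau_{\mathbf{M}_N}(P)|<\infty$ for every non-commutative polynomial $P$. Two unital subalgebras $\mathcal{A}_1,\mathcal{A}_2$ of a unital complex algebra $\mathcal{A}$ are free with respect to a linear functional $\tau$ if $\tau(a_1\cdots a_n)=0$ whenever $n\ge1$, $a_j\in\mathcal{A}_{i_j}$, $i_1\ne i_2\ne\cdots\ne i_n$ (consecutive indices differ) and $\tau(a_1)=\cdots=\tau(a_n)=0$. **Theorem.** Let $(\mathbf{A}_N)_{N\ge1}$ and $(\mathbf{B}_N)_{N\ge1}$ be deterministic sequences of $k$-tuples and $\ell$-tuples of $N\times N$ complex matrices, each bounded in non-commutative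 distribution, and let $(U_N)_{N\ge1}$ be random unitary matrices, $U_N$ being Haar distributed on the group of $N\times N$ unitary matrices. Write $U_N\mathbf{B}_NU_N^*$ for the tuple $(U_NB_N^{(j)}U_N^*)_{1\le j\le\ell}$, and $\tau_{\mathbf{A}_N,U_N\mathbf{B}_NU_N^*}$ for the non-commutative distribution of the joint $(k+\ell)$-tuple. 1. For every $N\ge1$ there is exactly one linear functional $\tau_{\mathbf{A}_N}\star\tau_{\mathbf{B}_N}$ on $\mathbb{C}\langle X_1,\ldots,X_k,Y_1,\ldots,Y_\ell\rangle$ (the free product) which extends both $\tau_{\mathbf{A}_N}$ on $\mathbb{C}\langle X_1,\ldots,X_k\rangle$ and $\tau_{\mathbf{B}_N}$ on $\mathbb{C}\langle Y_1,\ldots,Y_\ell\rangle$ and with respect to which $\mathbb{C}\langle X_1,\ldots,X_k\rangle$ and $\mathbb{C}\langle Y_1,\ldots,Y_\ell\rangle$ are free. 2. For every $P\in\mathbb{C}\langle X_1,\ldots,X_k,Y_1,\ldots,Y_\ell\rangle$, as $N\to\infty$, $$\mathbb{E}\big[\tau_{\mathbf{A}_N,U_N\mathbf{B}_NU_N^*}(P)\big]=\tau_{\mathbf{A}_N}\star\tau_{\mathbf{B}_N}(P)+O(N^{-2}).$$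 3. The algebras $\mathbb{C}\langle X_1,\ldots,X_k\rangle$ and $\mathbb{C}\langle Y_1,\ldots,Y_\ell\rangle$ are free up to order $O(N^{-2})$ with respect to the functionals $\tau_N=\mathbb{E}[\tau_{\mathbf{A}_N,U_N\mathbf{B}_NU_N^*}]$: each $\tau_N$ is a unital linear functional, and whenever $n\ge1$ and $a_1,\ldots,a_n$ are elements taken from the two algebras with consecutive $a_j,a_{j+1}$ taken from different ones, $$\tau_N\big((a_1-\tau_N(a_1))\cdots(a_n-\tau_N(a_n))\big)=O(N^{-2}).$$ -/

import Mathlib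

open MeasureTheory Filter Topology Asymptotics

noncomputable section

namespace AsympFree

/-! ### Non-commutative polynomials and freeness -/

/-- The inclusion `ℂ⟨X₁, …, X_k⟩ → ℂ⟨X₁, …, X_k, Y₁, …, Y_ℓ⟩`. -/
def inclX (k l : ℕ) : FreeAlgebra ℂ (Fin k) →ₐ[ℂ] FreeAlgebra ℂ (Fin k ⊕ Fin l) :=
  FreeAlgebra.lift ℂ fun i => FreeAlgebra.ι ℂ (Sum.inl i)

/-- The inclusion `ℂ⟨Y₁, …, Y_ℓ⟩ → ℂ⟨X₁, …, X_k, Y₁, …, Y_ℓ⟩`. -/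
def inclY (k l : ℕ) : FreeAlgebra ℂ (Fin l) →ₐ[ℂ] FreeAlgebra ℂ (Fin k ⊕ Fin l) :=
  FreeAlgebra.lift ℂ fun j => FreeAlgebra.ι ℂ (Sum.inr j)

/-- The subalgebras `ℂ⟨X⟩` (index `0`) and `ℂ⟨Y⟩` (index `1`) of `ℂ⟨X, Y⟩`. -/
def subalgXY (k l : ℕ) : Fin 2 → Subalgebra ℂ (FreeAlgebra ℂ (Fin k ⊕ Fin l)) :=
  ![(inclX k l).range, (inclY k l).range]

/-- `(a₁, …, a_{n+1})` is an alternating word in the subalgebras `S`: there are indices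
`i₁ ≠ i₂ ≠ ⋯ ≠ i_{n+1}` (consecutive ones differ) with `a_j ∈ S (i_j)` for every `j`. -/
def IsAlternating {𝒜 : Type*} [Ring 𝒜] [Algebra ℂ 𝒜] (S : Fin 2 → Subalgebra ℂ 𝒜)
    {n : ℕ} (a : Fin (n + 1) → 𝒜) : Prop :=
  ∃ i : Fin (n + 1) → Fin 2,
    (∀ j : Fin n, i j.castSucc ≠ i j.succ) ∧ ∀ j, a j ∈ S (i j)

/-- The two subalgebras `S 0`, `S 1` are free with respect to the linear functional `τ`. -/
def IsFree {𝒜 : Type*} [Ring 𝒜] [Algebra ℂ 𝒜] (S : Fin 2 → Subalgebra ℂ 𝒜)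
    (τ : 𝒜 →ₗ[ℂ] ℂ) : Prop :=
  ∀ (n : ℕ) (a : Fin (n + 1) → 𝒜), IsAlternating S a → (∀ j, τ (a j) = 0) →
    τ (List.ofFn a).prod = 0

/-- The two subalgebras `S 0`, `S 1` are free up to order `O(t²)` along the filter `f` with
respect to the family `τ x` of unital linear functionals, where `t x` is the small
parameter. -/
def IsFreeUpToOrderSq {𝒜 : Type*} [Ring 𝒜] [Algebra ℂ 𝒜] (S : Fin 2 → Subalgebra ℂ 𝒜)
    {ι : Type*} (f : Filter ι) (t : ι → ℝ) (τ : ι → 𝒜 →ₗ[ℂ] ℂ) : Prop :=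
  (∀ x, τ x 1 = 1) ∧
  ∀ (n : ℕ) (a : Fin (n + 1) → 𝒜), IsAlternating S a →
    (fun x => τ x (List.ofFn fun j => a j - algebraMap ℂ 𝒜 (τ x (a j))).prod)
      =O[f] fun x => t x ^ 2

/-- `τ` is a free product of the linear functionals `φ` on `ℂ⟨X⟩` and `ψ` on `ℂ⟨Y⟩`: it extends
both of them, and `ℂ⟨X⟩`, `ℂ⟨Y⟩` are free with respect to `τ`. -/
def IsFreeProduct {k l : ℕ} (φ : FreeAlgebra ℂ (Fin k) →ₗ[ℂ] ℂ)
    (ψ : FreeAlgebra ℂ (Fin l) →ₗ[ℂ] ℂ) (τ : FreeAlgebra ℂ (Fin k ⊕ Fin l) →ₗ[ℂ] ℂ) : Prop :=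
  (∀ P, τ (inclX k l P) = φ P) ∧ (∀ Q, τ (inclY k l Q) = ψ Q) ∧ IsFree (subalgXY k l) τ

/-- The free product `φ ⋆ ψ`: the linear functional with the property `IsFreeProduct φ ψ`
(the value is meaningful as soon as exactly one functional has this property). -/
def freeProduct {k l : ℕ} (φ : FreeAlgebra ℂ (Fin k) →ₗ[ℂ] ℂ)
    (ψ : FreeAlgebra ℂ (Fin l) →ₗ[ℂ] ℂ) : FreeAlgebra ℂ (Fin k ⊕ Fin l) →ₗ[ℂ] ℂ :=
  Classical.epsilon (IsFreeProduct φ ψ)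

/-! ### Non-commutative distributions of matrices -/

/-- The normalized trace `tr_N = (1 / N) Tr`. -/
def normTr (N : ℕ) : Matrix (Fin N) (Fin N) ℂ →ₗ[ℂ] ℂ :=
  (N : ℂ)⁻¹ • Matrix.traceLinearMap (Fin N) ℂ ℂ

/-- The non-commutative distribution `P ↦ tr_N (P(M))` of a tuple `M` of `N × N` matrices. -/
def ncDist {N : ℕ} {σ : Type*} (M : σ → Matrix (Fin N) (Fin N) ℂ) : FreeAlgebra ℂ σ →ₗ[ℂ] ℂ :=
  normTr N ∘ₗ (FreeAlgebra.lift ℂ M).toLinearMap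

/-- The joint non-commutative distribution `τ_{A,B}` of two tuples of `N × N` matrices. -/
def jointDist {N k l : ℕ} (A : Fin k → Matrix (Fin N) (Fin N) ℂ)
    (B : Fin l → Matrix (Fin N) (Fin N) ℂ) : FreeAlgebra ℂ (Fin k ⊕ Fin l) →ₗ[ℂ] ℂ :=
  ncDist (Sum.elim A B)

/-- A sequence of `k`-tuples of `N × N` matrices, `N ≥ 1`, is bounded in non-commutative
distribution. -/
def BoundedInDist {k : ℕ} (A : ∀ N : ℕ+, Fin k → Matrix (Fin N) (Fin N) ℂ) : Prop :=
  ∀ P : FreeAlgebra ℂ (Fin k), BddAbove (Set.range fun N : ℕ+ => ‖ncDist (A N) P‖)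

/-! ### Random unitary matrices -/

/-- The unitary group carries its Borel σ-algebra. -/
instance instMeasurableSpaceUnitaryGroup (N : ℕ) :
    MeasurableSpace (Matrix.unitaryGroup (Fin N) ℂ) := borel _

instance instBorelSpaceUnitaryGroup (N : ℕ) : BorelSpace (Matrix.unitaryGroup (Fin N) ℂ) := ⟨rfl⟩

/-- The conjugated tuple `u B u* = (u B₁ u*, …, u B_ℓ u*)`. -/
def conjTuple {N l : ℕ} (u : Matrix.unitaryGroup (Fin N) ℂ)
    (B : Fin l → Matrix (Fin N) (Fin N) ℂ) : Fin l → Matrix (Fin N) (Fin N) ℂ :=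
  fun j => (u : Matrix (Fin N) (Fin N) ℂ) * B j * star (u : Matrix (Fin N) (Fin N) ℂ)

instance instCompactSpaceUnitaryGroup (N : ℕ) :
    CompactSpace (Matrix.unitaryGroup (Fin N) ℂ) := by
  refine isCompact_iff_compactSpace.mp ?_
  have hK : IsCompact (Set.univ.pi fun _ : Fin N => Set.univ.pi fun _ : Fin N =>
      Metric.closedBall (0 : ℂ) 1) :=
    isCompact_univ_pi fun _ => isCompact_univ_pi fun _ => isCompact_closedBall _ _
  refine hK.of_isClosed_subset ?_ ?_
  · have h : (Matrix.unitaryGroup (Fin N) ℂ : Set (Matrix (Fin N) (Fin N) ℂ)) =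
        {M | star M * M = 1} ∩ {M | M * star M = 1} := by
      ext M; exact Unitary.mem_iff
    rw [h]
    exact (isClosed_eq (by fun_prop) continuous_const).inter
      (isClosed_eq (by fun_prop) continuous_const)
  · intro M hM i _ j _
    simpa using entry_norm_bound_of_unitary hM i j

theorem continuous_jointDist_conjTuple {N k l : ℕ} (A : Fin k → Matrix (Fin N) (Fin N) ℂ)
    (B : Fin l → Matrix (Fin N) (Fin N) ℂ) (P : FreeAlgebra ℂ (Fin k ⊕ Fin l)) :
    Continuous fun u : Matrix.unitaryGroup (Fin N) ℂ => jointDist A (conjTuple u B) P := by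
  have h : Continuous fun u : Matrix.unitaryGroup (Fin N) ℂ =>
      FreeAlgebra.lift ℂ (Sum.elim A (conjTuple u B)) P := by
    induction P using FreeAlgebra.induction with
    | grade0 r => simpa using continuous_const
    | grade1 x =>
      rcases x with i | j
      · simpa using continuous_const
      · simp only [FreeAlgebra.lift_ι_apply, Sum.elim_inr, conjTuple]
        fun_prop
    | mul a b ha hb => simp only [map_mul]; exact ha.mul hb
    | add a b ha hb => simp only [map_add]; exact ha.add hb
  have h2 : Continuous (normTr N) := by
    have : (normTr N : Matrix (Fin N) (Fin N) ℂ → ℂ) = fun M => (N : ℂ)⁻¹ * M.trace := rfl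
    rw [this]
    exact continuous_const.mul (Continuous.matrix_trace continuous_id)
  exact h2.comp h

theorem integrable_jointDist_conjTuple {Ω : Type*} [MeasurableSpace Ω] (ℙ : Measure Ω)
    [IsFiniteMeasure ℙ] {N k l : ℕ} {U : Ω → Matrix.unitaryGroup (Fin N) ℂ} (hU : Measurable U)
    (A : Fin k → Matrix (Fin N) (Fin N) ℂ) (B : Fin l → Matrix (Fin N) (Fin N) ℂ)
    (P : FreeAlgebra ℂ (Fin k ⊕ Fin l)) :
    Integrable (fun ω => jointDist A (conjTuple (U ω) B) P) ℙ := by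
  have hc := continuous_jointDist_conjTuple A B P
  obtain ⟨C, hC⟩ := isCompact_univ.exists_bound_of_continuousOn hc.continuousOn
  exact Integrable.of_bound (hc.measurable.comp hU).aestronglyMeasurable C
    (Eventually.of_forall fun ω => hC _ (Set.mem_univ _))

/-- The linear functional `P ↦ 𝔼[τ_{A, U B U*}(P)]`, for a random unitary matrix `U`. -/
def expectedDist {Ω : Type*} [MeasurableSpace Ω] (ℙ : Measure Ω) [IsFiniteMeasure ℙ]
    {N k l : ℕ} {U : Ω → Matrix.unitaryGroup (Fin N) ℂ} (hU : Measurable U)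
    (A : Fin k → Matrix (Fin N) (Fin N) ℂ) (B : Fin l → Matrix (Fin N) (Fin N) ℂ) :
    FreeAlgebra ℂ (Fin k ⊕ Fin l) →ₗ[ℂ] ℂ where
  toFun P := ∫ ω, jointDist A (conjTuple (U ω) B) P ∂ℙ
  map_add' P Q := by
    simp only [map_add]
    exact integral_add (integrable_jointDist_conjTuple ℙ hU A B P)
      (integrable_jointDist_conjTuple ℙ hU A B Q)
  map_smul' c P := by
    simp only [map_smul, RingHom.id_apply]
    exact integral_smul c _

end AsympFree

end

noncomputable section

namespace AsympFree

open scoped TensorProduct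

/-! ### Centered alternating words -/

/-! The argument compares two solutions of one hierarchy of equations. Let `∂` (`dq`) be the
derivation with `∂X = 0` and `∂Y = 1 ⊗ Y - Y ⊗ 1`, which encodes the infinitesimal conjugation of
the `Y` variables. Left invariance of Haar measure under `u ↦ exp(itH) u` allows integration by
parts, and summing over matrix units yields a Schwinger–Dyson equation for the expectations of
products of normalized traces: `E[(tr ⊗ tr)(∂P) ∏ tr Q_i]` plus `N⁻²` times terms in which `P` is
inserted into one of the `Q_i` is zero (`haar_loopEq`).

The free product solves the same hierarchy with `N⁻²` replaced by `0`. Indeed `(τ ⊗ τ) ∘ ∂` kills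
every product of a centered alternating word, since only cuts between letters occur, and such
products span the algebra (`tensorSq_dq_eq_zero`). The spanning also gives uniqueness of the free
product; existence comes from the vacuum state of an explicit representation on a space of words.

For words in letters `b a` with `b ∈ ℂ⟨Y⟩`, `a ∈ ℂ⟨X⟩`, the equation can be solved for the moment of
an uncut word. The other terms either have fewer letters, or the same number of letters in more
words, or carry the factor `ε = N⁻²`. With `ε = 0` this determines the moments by induction. For
small `ε`, let `Δ` be the total discrepancy over the finitely many configurations with given letters
and letter count; then `Δ = O(ε (1 + Δ))`, hence `Δ = O(ε)` (`LoopEq.sub_isBigO`).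

Freeness up to order `O(N⁻²)` follows by expanding the centered product: the centering constants are
bounded and coincide with those of the free product, for which that product has value zero. -/

/-- The product of the elements of a labelled word. -/
def wordProd {𝒜 : Type*} [Ring 𝒜] (L : List (Fin 2 × 𝒜)) : 𝒜 := (L.map Prod.snd).prod

@[simp] theorem wordProd_nil {𝒜 : Type*} [Ring 𝒜] : wordProd ([] : List (Fin 2 × 𝒜)) = 1 := rfl

@[simp] theorem wordProd_cons {𝒜 : Type*} [Ring 𝒜] (x : Fin 2 × 𝒜) (L) :
    wordProd (x :: L) = x.2 * wordProd L := by
  simp [wordProd]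

@[simp] theorem wordProd_append {𝒜 : Type*} [Ring 𝒜] (L L' : List (Fin 2 × 𝒜)) :
    wordProd (L ++ L') = wordProd L * wordProd L' := by
  simp [wordProd]

section CenteredWords

variable {𝒜 : Type*} [Ring 𝒜] [Algebra ℂ 𝒜] {S : Fin 2 → Subalgebra ℂ 𝒜} {τ : 𝒜 →ₗ[ℂ] ℂ}

/-- A list of elements labelled by the subalgebra they are taken from, with alternating labels,
all of whose entries are centered. -/
def IsCenteredWord (S : Fin 2 → Subalgebra ℂ 𝒜) (τ : 𝒜 →ₗ[ℂ] ℂ) (L : List (Fin 2 × 𝒜)) : Prop :=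
  L.IsChain (fun x y => x.1 ≠ y.1) ∧ ∀ x ∈ L, x.2 ∈ S x.1 ∧ τ x.2 = 0

theorem IsCenteredWord.nil : IsCenteredWord S τ [] := ⟨List.isChain_nil, by simp⟩

theorem IsCenteredWord.tail {x L} (h : IsCenteredWord S τ (x :: L)) : IsCenteredWord S τ L :=
  ⟨(List.isChain_cons.1 h.1).2, fun y hy => h.2 y (by simp [hy])⟩

theorem IsCenteredWord.left {L L'} (h : IsCenteredWord S τ (L ++ L')) : IsCenteredWord S τ L :=
  ⟨h.1.left_of_append, fun y hy => h.2 y (by simp [hy])⟩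

theorem IsCenteredWord.right {L L'} (h : IsCenteredWord S τ (L ++ L')) : IsCenteredWord S τ L' :=
  ⟨h.1.right_of_append, fun y hy => h.2 y (by simp [hy])⟩

theorem IsCenteredWord.cons {x : Fin 2 × 𝒜} {L} (h : IsCenteredWord S τ L)
    (hx : x.2 ∈ S x.1) (h0 : τ x.2 = 0) (hL : ∀ y ∈ L.head?, x.1 ≠ y.1) :
    IsCenteredWord S τ (x :: L) := by
  refine ⟨List.isChain_cons.2 ⟨hL, h.1⟩, fun y hy => ?_⟩
  rcases List.mem_cons.1 hy with rfl | hy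
  exacts [⟨hx, h0⟩, h.2 y hy]

theorem IsCenteredWord.concat {x : Fin 2 × 𝒜} {L} (h : IsCenteredWord S τ L)
    (hx : x.2 ∈ S x.1) (h0 : τ x.2 = 0) (hL : ∀ y ∈ L.getLast?, y.1 ≠ x.1) :
    IsCenteredWord S τ (L ++ [x]) := by
  refine ⟨List.isChain_append.2 ⟨h.1, List.isChain_singleton _, by simpa using hL⟩, fun y hy => ?_⟩
  rcases List.mem_append.1 hy with hy | hy
  · exact h.2 y hy
  · rw [List.mem_singleton.1 hy]; exact ⟨hx, h0⟩

theorem IsFree.apply_wordProd (hτ : IsFree S τ) {L} (hL : IsCenteredWord S τ L) (hne : L ≠ []) :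
    τ (wordProd L) = 0 := by
  obtain ⟨n, hn⟩ : ∃ n, L.length = n + 1 :=
    ⟨L.length - 1, (Nat.succ_pred_eq_of_pos (List.length_pos_iff.2 hne)).symm⟩
  have key := hτ n (fun j => (L.get (j.cast hn.symm)).2)
    ⟨fun j => (L.get (j.cast hn.symm)).1, fun j => ?_, fun j => (hL.2 _ (List.get_mem _ _)).1⟩
    fun j => (hL.2 _ (List.get_mem _ _)).2
  · rw [← key]
    congr 1
    unfold wordProd
    congr 1
    apply List.ext_get
    · simp [hn]
    · intro m h1 h2
      simp [-List.ofFn_succ]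
  · have := List.isChain_iff_getElem.1 hL.1 j (by omega)
    simpa using this

theorem isFree_of_wordProd
    (h : ∀ L, IsCenteredWord S τ L → L ≠ [] → τ (wordProd L) = 0) : IsFree S τ := by
  rintro n a ⟨i, hi, ha⟩ h0
  have := h (List.ofFn fun j => (i j, a j)) ⟨?_, ?_⟩ (by simp)
  · rw [← this]
    simp [wordProd, List.map_ofFn, Function.comp_def]
  · rw [List.isChain_iff_getElem]
    intro m hm
    have hm' : m + 1 < n + 1 := by simpa using hm
    simp only [List.getElem_ofFn]
    exact hi ⟨m, by omega⟩
  · intro x hx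
    obtain ⟨j, rfl⟩ := (List.mem_ofFn' _ _).1 hx
    exact ⟨ha j, h0 j⟩

/-- The linear span of the products of centered words. -/
def centeredSpan (S : Fin 2 → Subalgebra ℂ 𝒜) (τ : 𝒜 →ₗ[ℂ] ℂ) : Submodule ℂ 𝒜 :=
  Submodule.span ℂ (wordProd '' {L | IsCenteredWord S τ L})

theorem wordProd_mem_centeredSpan {L} (h : IsCenteredWord S τ L) :
    wordProd L ∈ centeredSpan S τ :=
  Submodule.subset_span ⟨L, h, rfl⟩

theorem sub_algebraMap_mem {c : Fin 2} {x : 𝒜} (hx : x ∈ S c) (z : ℂ) :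
    x - algebraMap ℂ 𝒜 z ∈ S c :=
  (S c).sub_mem hx ((S c).algebraMap_mem _)

theorem apply_sub_algebraMap (h1 : τ 1 = 1) (x : 𝒜) : τ (x - algebraMap ℂ 𝒜 (τ x)) = 0 := by
  rw [Algebra.algebraMap_eq_smul_one, map_sub, map_smul, h1]; simp

/-- Splitting `x` into its centered part and a scalar either prepends a legitimate new letter or
leaves the word unchanged. -/
theorem mul_wordProd_mem_of_head_ne (h1 : τ 1 = 1) {c : Fin 2} {x : 𝒜} (hx : x ∈ S c) {L}
    (hL : IsCenteredWord S τ L) (hc : ∀ y ∈ L.head?, c ≠ y.1) :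
    x * wordProd L ∈ centeredSpan S τ := by
  have h : x * wordProd L =
      wordProd ((c, x - algebraMap ℂ 𝒜 (τ x)) :: L) + τ x • wordProd L := by
    simp [sub_mul, Algebra.algebraMap_eq_smul_one]
  rw [h]
  exact add_mem (wordProd_mem_centeredSpan
    (hL.cons (sub_algebraMap_mem hx _) (apply_sub_algebraMap h1 x) hc))
    (Submodule.smul_mem _ _ (wordProd_mem_centeredSpan hL))

theorem mul_mem_centeredSpan (h1 : τ 1 = 1) {c : Fin 2} {x y : 𝒜} (hx : x ∈ S c)
    (hy : y ∈ centeredSpan S τ) : x * y ∈ centeredSpan S τ := by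
  induction hy using Submodule.span_induction with
  | zero => simp
  | add y z _ _ hy hz => rw [mul_add]; exact add_mem hy hz
  | smul r y _ hy => rw [mul_smul_comm]; exact Submodule.smul_mem _ _ hy
  | mem y hy =>
    obtain ⟨L, hL, rfl⟩ := hy
    by_cases hc : ∀ y ∈ L.head?, c ≠ y.1
    · exact mul_wordProd_mem_of_head_ne h1 hx hL hc
    · rcases L with _ | ⟨⟨c', y⟩, L⟩
      · simp at hc
      · obtain rfl : c = c' := by simpa using hc
        -- When the labels agree, `x` is absorbed into the first letter; the product lies in the
        -- same subalgebra and the remaining word starts with the other label.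
        rw [wordProd_cons, ← mul_assoc]
        exact mul_wordProd_mem_of_head_ne h1 ((S c).mul_mem hx (hL.2 (c, y) (by simp)).1)
          hL.tail (List.isChain_cons.1 hL.1).1

/-- Two letters are needed: if `x` merges with the first one, a non-empty centered word remains, so
both the centered part and the scalar part of the merged letter contribute zero. -/
theorem IsFree.apply_mul_wordProd (h1 : τ 1 = 1) (hτ : IsFree S τ) {c : Fin 2} {x : 𝒜}
    (hx : x ∈ S c) {y z : Fin 2 × 𝒜} {L} (hL : IsCenteredWord S τ (y :: z :: L)) :
    τ (x * wordProd (y :: z :: L)) = 0 := by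
  have aux : ∀ {c : Fin 2} {x : 𝒜}, x ∈ S c → ∀ {L}, IsCenteredWord S τ L → L ≠ [] →
      (∀ y ∈ L.head?, c ≠ y.1) → τ (x * wordProd L) = 0 := by
    intro c x hx L hL hne hc
    have h : x * wordProd L =
        wordProd ((c, x - algebraMap ℂ 𝒜 (τ x)) :: L) + τ x • wordProd L := by
      simp [sub_mul, Algebra.algebraMap_eq_smul_one]
    rw [h, map_add, map_smul, hτ.apply_wordProd hL hne, hτ.apply_wordProd
      (hL.cons (sub_algebraMap_mem hx _) (apply_sub_algebraMap h1 x) hc) (by simp)]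
    simp
  by_cases hc : c = y.1
  · rw [wordProd_cons, ← mul_assoc]
    exact aux ((S c).mul_mem hx (hc ▸ (hL.2 y (by simp)).1)) hL.tail (by simp)
      (hc ▸ (List.isChain_cons.1 hL.1).1)
  · exact aux hx hL (by simp) (by simpa using hc)

theorem IsFree.apply_wordProd_mul (h1 : τ 1 = 1) (hτ : IsFree S τ) {c : Fin 2} {x : 𝒜}
    (hx : x ∈ S c) {y z : Fin 2 × 𝒜} {L} (hL : IsCenteredWord S τ (L ++ [z] ++ [y])) :
    τ (wordProd (L ++ [z] ++ [y]) * x) = 0 := by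
  have aux : ∀ {c : Fin 2} {x : 𝒜}, x ∈ S c → ∀ {L}, IsCenteredWord S τ L → L ≠ [] →
      (∀ y ∈ L.getLast?, y.1 ≠ c) → τ (wordProd L * x) = 0 := by
    intro c x hx L hL hne hc
    have h : wordProd L * x =
        wordProd (L ++ [(c, x - algebraMap ℂ 𝒜 (τ x))]) + τ x • wordProd L := by
      simp [mul_sub, Algebra.algebraMap_eq_smul_one]
    rw [h, map_add, map_smul, hτ.apply_wordProd hL hne, hτ.apply_wordProd
      (hL.concat (sub_algebraMap_mem hx _) (apply_sub_algebraMap h1 x) hc) (by simp)]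
    simp
  by_cases hc : c = y.1
  · rw [wordProd_append, mul_assoc]
    refine aux (c := c) ?_ hL.left (by simp) ?_
    · simpa using (S c).mul_mem (hc ▸ (hL.2 y (by simp)).1) hx
    · have := (List.isChain_append.1 hL.1).2.2
      simpa [hc] using this
  · exact aux hx hL (by simp) (by simpa using fun h => hc h.symm)

/-- If `τ` is tracial on each of two free subalgebras, then each of them commutes under `τ` with
the products of centered words. -/
theorem IsFree.apply_mul_comm (h1 : τ 1 = 1) (hτ : IsFree S τ)
    (htr : ∀ c, ∀ x ∈ S c, ∀ y ∈ S c, τ (x * y) = τ (y * x)) {c : Fin 2} {x : 𝒜} (hx : x ∈ S c)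
    {y : 𝒜} (hy : y ∈ centeredSpan S τ) : τ (x * y) = τ (y * x) := by
  induction hy using Submodule.span_induction with
  | zero => simp
  | add y z _ _ hy hz => simp only [mul_add, add_mul, map_add, hy, hz]
  | smul r y _ hy => simp only [mul_smul_comm, smul_mul_assoc, map_smul, hy]
  | mem y hy =>
    obtain ⟨L, hL, rfl⟩ := hy
    rcases L with _ | ⟨⟨c', y⟩, _ | ⟨z, L⟩⟩
    · simp
    · have hy := hL.2 (c', y) (by simp)
      by_cases hc : c = c'
      · subst hc
        simpa using htr c x hx y hy.1
      · have hx' : x = (x - algebraMap ℂ 𝒜 (τ x)) + τ x • 1 := by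
          simp [Algebra.algebraMap_eq_smul_one]
        have e1 := hτ.apply_wordProd (hL.cons (x := (c, x - algebraMap ℂ 𝒜 (τ x)))
          (sub_algebraMap_mem hx _) (apply_sub_algebraMap h1 x) (by simpa using hc)) (by simp)
        have e2 := hτ.apply_wordProd (hL.concat (x := (c, x - algebraMap ℂ 𝒜 (τ x)))
          (sub_algebraMap_mem hx _) (apply_sub_algebraMap h1 x)
          (by simpa using fun h => hc h.symm)) (by simp)
        rw [hx', add_mul, mul_add, map_add, map_add]
        simp at e1 e2
        simp [e1, e2]
    -- For words of length at least two both sides vanish. The last two letters are exposed by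
    -- removing the final letter twice.
    · rw [hτ.apply_mul_wordProd h1 hx hL]
      have hL' := hL
      rw [← List.dropLast_append_getLast (l := (c', y) :: z :: L) (by simp)] at hL' ⊢
      rw [← List.dropLast_append_getLast (l := ((c', y) :: z :: L).dropLast) (by simp)] at hL' ⊢
      exact (hτ.apply_wordProd_mul h1 hx hL').symm

end CenteredWords

/-! ### The free product of two functionals -/

section FreeProduct

variable {k l : ℕ}

theorem inclX_mem (a : FreeAlgebra ℂ (Fin k)) : inclX k l a ∈ subalgXY k l 0 := ⟨a, rfl⟩

theorem inclY_mem (b : FreeAlgebra ℂ (Fin l)) : inclY k l b ∈ subalgXY k l 1 := ⟨b, rfl⟩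

@[simp] theorem inclX_ι (i : Fin k) :
    inclX k l (FreeAlgebra.ι ℂ i) = FreeAlgebra.ι ℂ (Sum.inl i) := by simp [inclX]

@[simp] theorem inclY_ι (j : Fin l) :
    inclY k l (FreeAlgebra.ι ℂ j) = FreeAlgebra.ι ℂ (Sum.inr j) := by simp [inclY]

/-- The subalgebra which a generator belongs to. -/
def color (x : Fin k ⊕ Fin l) : Fin 2 := Sum.elim (fun _ => 0) (fun _ => 1) x

theorem ι_mem (x : Fin k ⊕ Fin l) : FreeAlgebra.ι ℂ x ∈ subalgXY k l (color x) := by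
  rcases x with i | j
  · rw [← inclX_ι]; exact inclX_mem _
  · rw [← inclY_ι]; exact inclY_mem _

/-- The span contains `1` as the empty word and is stable under left multiplication by each
generator, hence by every polynomial. -/
theorem centeredSpan_eq_top {τ : FreeAlgebra ℂ (Fin k ⊕ Fin l) →ₗ[ℂ] ℂ} (h1 : τ 1 = 1) :
    centeredSpan (subalgXY k l) τ = ⊤ := by
  refine eq_top_iff.2 fun P _ => ?_
  suffices h : ∀ Q ∈ centeredSpan (subalgXY k l) τ, P * Q ∈ centeredSpan (subalgXY k l) τ by
    simpa using h 1 (wordProd_mem_centeredSpan IsCenteredWord.nil)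
  clear * - h1
  induction P using FreeAlgebra.induction with
  | grade0 r =>
    intro Q hQ
    rw [← Algebra.smul_def]
    exact Submodule.smul_mem _ _ hQ
  | grade1 x => exact fun Q hQ => mul_mem_centeredSpan h1 (ι_mem x) hQ
  | mul a b ha hb =>
    intro Q hQ
    rw [mul_assoc]
    exact ha _ (hb _ hQ)
  | add a b ha hb =>
    intro Q hQ
    rw [add_mul]
    exact add_mem (ha _ hQ) (hb _ hQ)

/-- Two unital free functionals which agree on both subalgebras are equal. -/
theorem eq_of_isFree {τ τ' : FreeAlgebra ℂ (Fin k ⊕ Fin l) →ₗ[ℂ] ℂ} (h1 : τ 1 = 1)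
    (hτ : IsFree (subalgXY k l) τ) (hτ' : IsFree (subalgXY k l) τ')
    (h : ∀ c, ∀ x ∈ subalgXY k l c, τ x = τ' x) : τ = τ' := by
  ext P
  have hP : P ∈ centeredSpan (subalgXY k l) τ := by rw [centeredSpan_eq_top h1]; trivial
  induction hP using Submodule.span_induction with
  | zero => simp
  | add y z _ _ hy hz => rw [map_add, map_add, hy, hz]
  | smul r y _ hy => rw [map_smul, map_smul, hy]
  | mem y hy =>
    obtain ⟨L, hL, rfl⟩ := hy
    by_cases hne : L = []
    · subst hne; exact h 0 1 (one_mem _)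
    · have hL' : IsCenteredWord (subalgXY k l) τ' L :=
        ⟨hL.1, fun x hx => ⟨(hL.2 x hx).1, by rw [← h _ _ (hL.2 x hx).1, (hL.2 x hx).2]⟩⟩
      rw [hτ.apply_wordProd hL hne, hτ'.apply_wordProd hL' hne]

/-! #### Construction of the free product on the space of words -/

/-- The monomial of a word. -/
def monomial (w : List (Fin k ⊕ Fin l)) : FreeAlgebra ℂ (Fin k ⊕ Fin l) :=
  (w.map (FreeAlgebra.ι ℂ)).prod

@[simp] theorem monomial_nil : monomial ([] : List (Fin k ⊕ Fin l)) = 1 := rfl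

@[simp] theorem monomial_cons (x) (w : List (Fin k ⊕ Fin l)) :
    monomial (x :: w) = FreeAlgebra.ι ℂ x * monomial w := by simp [monomial]

@[simp] theorem monomial_append (v w : List (Fin k ⊕ Fin l)) :
    monomial (v ++ w) = monomial v * monomial w := by simp [monomial]

theorem subalgXY_le_span (c : Fin 2) {x} (hx : x ∈ subalgXY k l c) :
    x ∈ Submodule.span ℂ (monomial '' {w | ∀ y ∈ w, color y = c}) := by
  have hmul : ∀ a b, a ∈ Submodule.span ℂ (monomial (k := k) (l := l) '' {w | ∀ y ∈ w, color y = c})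
      → b ∈ Submodule.span ℂ (monomial '' {w | ∀ y ∈ w, color y = c}) →
      a * b ∈ Submodule.span ℂ (monomial '' {w | ∀ y ∈ w, color y = c}) := by
    intro a b ha hb
    have := Submodule.mul_mem_mul ha hb
    rw [Submodule.span_mul_span] at this
    refine Submodule.span_mono ?_ this
    rintro _ ⟨_, ⟨v, hv, rfl⟩, _, ⟨w, hw, rfl⟩, rfl⟩
    refine ⟨v ++ w, fun y hy => ?_, by simp⟩
    rcases List.mem_append.1 hy with hy | hy
    exacts [hv y hy, hw y hy]
  have hsc : ∀ r : ℂ, algebraMap ℂ (FreeAlgebra ℂ (Fin k ⊕ Fin l)) r ∈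
      Submodule.span ℂ (monomial '' {w | ∀ y ∈ w, color y = c}) := by
    intro r
    rw [Algebra.algebraMap_eq_smul_one]
    exact Submodule.smul_mem _ _ (Submodule.subset_span ⟨[], by simp, rfl⟩)
  have hι : ∀ y : Fin k ⊕ Fin l, color y = c → FreeAlgebra.ι ℂ y ∈
      Submodule.span ℂ (monomial '' {w | ∀ y ∈ w, color y = c}) := fun y hy =>
    Submodule.subset_span ⟨[y], by rintro z hz; rw [List.mem_singleton.1 hz, hy], by simp⟩
  fin_cases c
  · obtain ⟨a, rfl⟩ := hx
    induction a using FreeAlgebra.induction with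
    | grade0 r => simpa using hsc r
    | grade1 i => simpa using hι (Sum.inl i) rfl
    | mul a b ha hb => simpa using hmul _ _ ha hb
    | add a b ha hb => simpa using add_mem ha hb
  · obtain ⟨a, rfl⟩ := hx
    induction a using FreeAlgebra.induction with
    | grade0 r => simpa using hsc r
    | grade1 i => simpa using hι (Sum.inr i) rfl
    | mul a b ha hb => simpa using hmul _ _ ha hb
    | add a b ha hb => simpa using add_mem ha hb

section Construction

variable (θ : Fin 2 → FreeAlgebra ℂ (Fin k ⊕ Fin l) →ₗ[ℂ] ℂ)

open Classical in
/-- The action of a generator on a basis vector of the space of words; the word `w₁ w₂ ⋯` with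
monochromatic blocks `w_i` stands for the product of the centered monomials of the `w_i`. -/
def genActAux (x : Fin k ⊕ Fin l) (w : List (Fin k ⊕ Fin l)) : List (Fin k ⊕ Fin l) →₀ ℂ :=
  let u := w.takeWhile fun y => color y = color x
  let r := w.dropWhile fun y => color y = color x
  -- Write `p°` for the centering of `p`. If no block of the colour of `x` is in front, then `x = x°
  -- + θ(x)`. Otherwise `x u° = (xu)° + θ(xu) - θ(u) x° - θ(u) θ(x)`, which gives the coefficients
  -- below.
  if u = [] then
    Finsupp.single (x :: w) 1 + θ (color x) (monomial [x]) • Finsupp.single w 1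
  else
    Finsupp.single (x :: w) 1 - θ (color x) (monomial u) • Finsupp.single (x :: r) 1 +
      (θ (color x) (monomial (x :: u)) -
        θ (color x) (monomial u) * θ (color x) (monomial [x])) • Finsupp.single r 1

/-- The representation of `ℂ⟨X, Y⟩` on the space of words. -/
def wordRep : FreeAlgebra ℂ (Fin k ⊕ Fin l) →ₐ[ℂ]
    Module.End ℂ (List (Fin k ⊕ Fin l) →₀ ℂ) :=
  FreeAlgebra.lift ℂ fun x => Finsupp.linearCombination ℂ (genActAux θ x)

theorem wordRep_ι_single (x : Fin k ⊕ Fin l) (w) :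
    wordRep θ (FreeAlgebra.ι ℂ x) (Finsupp.single w 1) = genActAux θ x w := by
  simp [wordRep]

/-- This confirms the reading of a block as a centered monomial: `u` acts on `r` as `u° + θ(u)`. In
the induction on `u` the correction terms built into `genActAux` cancel. -/
theorem wordRep_monomial_single {c : Fin 2} (u : List (Fin k ⊕ Fin l)) (hu : ∀ y ∈ u, color y = c)
    (hne : u ≠ []) (r : List (Fin k ⊕ Fin l)) (hr : ∀ y ∈ r.head?, color y ≠ c) :
    wordRep θ (monomial u) (Finsupp.single r 1) =
      Finsupp.single (u ++ r) 1 + θ c (monomial u) • Finsupp.single r 1 := by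
  have htake : ∀ v : List (Fin k ⊕ Fin l), (∀ y ∈ v, color y = c) →
      (v ++ r).takeWhile (fun y => color y = c) = v ∧
      (v ++ r).dropWhile (fun y => color y = c) = r := by
    intro v hv
    rw [List.takeWhile_append_of_pos (by simpa using hv),
      List.dropWhile_append_of_pos (by simpa using hv)]
    rcases r with _ | ⟨y, r⟩
    · simp
    · have : color y ≠ c := by simpa using hr
      simp [this]
  induction u with
  | nil => exact absurd rfl hne
  | cons x u ih =>
    have hx : color x = c := hu x (by simp)
    have hu' : ∀ y ∈ u, color y = c := fun y hy => hu y (by simp [hy])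
    obtain ⟨h0t, h0d⟩ := htake [] (by simp)
    rw [monomial_cons, map_mul, Module.End.mul_apply]
    by_cases hu0 : u = []
    · subst hu0
      simp only [List.nil_append] at h0t
      rw [monomial_nil, map_one, Module.End.one_apply, wordRep_ι_single]
      simp [genActAux, hx, h0t]
    · obtain ⟨h1t, h1d⟩ := htake u hu'
      simp only [List.nil_append] at h0t
      rw [ih hu' hu0, map_add, map_smul, wordRep_ι_single, wordRep_ι_single]
      simp only [genActAux, hx, h0t, h1t, h1d, hu0, if_true, if_false, List.cons_append,
        monomial_cons, monomial_nil, mul_one]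
      module

/-- The span of the words which start with colour `c`. -/
def headSpan (k l : ℕ) (c : Fin 2) : Submodule ℂ (List (Fin k ⊕ Fin l) →₀ ℂ) :=
  Submodule.span ℂ ((fun w => Finsupp.single w 1) '' {w | ∃ y ∈ w.head?, color y = c})

theorem wordRep_sub_mem_headSpan (hθ : ∀ c, θ c 1 = 1) {c : Fin 2} {a}
    (ha : a ∈ subalgXY k l c) (r : List (Fin k ⊕ Fin l)) (hr : ∀ y ∈ r.head?, color y ≠ c) :
    wordRep θ a (Finsupp.single r 1) - θ c a • Finsupp.single r 1 ∈ headSpan k l c := by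
  replace ha := subalgXY_le_span c ha
  induction ha using Submodule.span_induction with
  | zero => simp
  | add y z _ _ hy hz =>
    have h := add_mem hy hz
    rw [map_add, map_add, LinearMap.add_apply, add_smul]
    convert! h using 1
    abel
  | smul s y _ hy =>
    rw [map_smul, map_smul, LinearMap.smul_apply, smul_assoc, ← smul_sub]
    exact Submodule.smul_mem _ _ hy
  | mem y hy =>
    obtain ⟨u, hu, rfl⟩ := hy
    by_cases hne : u = []
    · subst hne; simp [hθ]
    · rw [wordRep_monomial_single θ u hu hne r hr, add_sub_cancel_right]
      refine Submodule.subset_span ⟨u ++ r, ?_, rfl⟩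
      rcases u with _ | ⟨x, u⟩
      · exact absurd rfl hne
      · exact ⟨x, by simp, hu x (by simp)⟩

theorem headSpan_apply_nil {c : Fin 2} {v} (hv : v ∈ headSpan k l c) : v [] = 0 := by
  induction hv using Submodule.span_induction with
  | zero => simp
  | add y z _ _ hy hz => simp [hy, hz]
  | smul s y _ hy => simp [hy]
  | mem y hy =>
    obtain ⟨u, hu, rfl⟩ := hy
    have : u ≠ [] := by rintro rfl; simp at hu
    simp [this]

/-- A centered element of one colour acts as pure creation on words starting with the other colour;
this is the mechanism behind freeness of the vacuum state. -/
theorem wordRep_mem_headSpan (hθ : ∀ c, θ c 1 = 1) {c c' : Fin 2} (hc : c ≠ c') {a}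
    (ha : a ∈ subalgXY k l c) (h0 : θ c a = 0) {v} (hv : v ∈ headSpan k l c') :
    wordRep θ a v ∈ headSpan k l c := by
  induction hv using Submodule.span_induction with
  | zero => simp
  | add y z _ _ hy hz => rw [map_add]; exact add_mem hy hz
  | smul s y _ hy => rw [map_smul]; exact Submodule.smul_mem _ _ hy
  | mem y hy =>
    obtain ⟨u, ⟨x, hx, hxc⟩, rfl⟩ := hy
    have := wordRep_sub_mem_headSpan θ hθ ha u (fun y hy => by
      rw [Option.mem_unique hy hx, hxc]; exact hc.symm)
    simpa [h0] using this

/-- The vacuum state of the representation on the space of words. -/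
def vacuumState : FreeAlgebra ℂ (Fin k ⊕ Fin l) →ₗ[ℂ] ℂ :=
  Finsupp.lapply [] ∘ₗ LinearMap.applyₗ (Finsupp.single [] 1) ∘ₗ (wordRep θ).toLinearMap

theorem vacuumState_apply (P) :
    vacuumState θ P = wordRep θ P (Finsupp.single [] 1) [] := rfl

theorem vacuumState_of_mem (hθ : ∀ c, θ c 1 = 1) {c : Fin 2} {a} (ha : a ∈ subalgXY k l c) :
    vacuumState θ a = θ c a := by
  have := headSpan_apply_nil (wordRep_sub_mem_headSpan θ hθ ha [] (by simp))
  rw [vacuumState_apply]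
  simpa [sub_eq_zero] using this

/-- Applied to the vacuum from right to left, the letters of a centered word only create, so the
result is supported on non-empty words and has no vacuum component. -/
theorem isFree_vacuumState (hθ : ∀ c, θ c 1 = 1) : IsFree (subalgXY k l) (vacuumState θ) := by
  refine isFree_of_wordProd fun L hL hne => ?_
  have key : ∀ (x) (L), IsCenteredWord (subalgXY k l) (vacuumState θ) (x :: L) →
      wordRep θ (wordProd (x :: L)) (Finsupp.single [] 1) ∈ headSpan k l x.1 := by
    intro x L hL
    induction L generalizing x with
    | nil =>
      have hx := hL.2 x (by simp)
      have := wordRep_sub_mem_headSpan θ hθ hx.1 [] (by simp)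
      rw [← vacuumState_of_mem θ hθ hx.1, hx.2] at this
      simpa using this
    | cons y L ih =>
      have hx := hL.2 x (by simp)
      rw [wordProd_cons, map_mul, Module.End.mul_apply]
      exact wordRep_mem_headSpan θ hθ (by simpa using (List.isChain_cons.1 hL.1).1) hx.1
        (by rw [← vacuumState_of_mem θ hθ hx.1, hx.2]) (ih y hL.tail)
  rcases L with _ | ⟨x, L⟩
  · exact absurd rfl hne
  · exact headSpan_apply_nil (key x L hL)

end Construction

theorem exists_isFreeProduct (φ : FreeAlgebra ℂ (Fin k) →ₗ[ℂ] ℂ) (ψ : FreeAlgebra ℂ (Fin l) →ₗ[ℂ] ℂ)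
    (hφ : φ 1 = 1) (hψ : ψ 1 = 1) : ∃ τ, IsFreeProduct φ ψ τ := by
  -- The word construction takes functionals on the whole algebra, so `φ` and `ψ` are pulled back
  -- along the retractions that send the other family of variables to zero.
  let πX : FreeAlgebra ℂ (Fin k ⊕ Fin l) →ₐ[ℂ] FreeAlgebra ℂ (Fin k) :=
    FreeAlgebra.lift ℂ (Sum.elim (FreeAlgebra.ι ℂ) 0)
  let πY : FreeAlgebra ℂ (Fin k ⊕ Fin l) →ₐ[ℂ] FreeAlgebra ℂ (Fin l) :=
    FreeAlgebra.lift ℂ (Sum.elim 0 (FreeAlgebra.ι ℂ))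
  have hX : ∀ P, πX (inclX k l P) = P := by
    intro P
    have : πX.comp (inclX k l) = AlgHom.id ℂ _ := by ext i; simp [πX]
    exact DFunLike.congr_fun this P
  have hY : ∀ P, πY (inclY k l P) = P := by
    intro P
    have : πY.comp (inclY k l) = AlgHom.id ℂ _ := by ext i; simp [πY]
    exact DFunLike.congr_fun this P
  let θ : Fin 2 → FreeAlgebra ℂ (Fin k ⊕ Fin l) →ₗ[ℂ] ℂ :=
    ![φ ∘ₗ πX.toLinearMap, ψ ∘ₗ πY.toLinearMap]
  have hθ : ∀ c, θ c 1 = 1 := by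
    intro c
    fin_cases c
    · simp [θ, hφ]
    · simp [θ, hψ]
  refine ⟨vacuumState θ, fun P => ?_, fun Q => ?_, isFree_vacuumState θ hθ⟩
  · rw [vacuumState_of_mem θ hθ (inclX_mem P)]; simp [θ, hX]
  · rw [vacuumState_of_mem θ hθ (inclY_mem Q)]; simp [θ, hY]

theorem IsFreeProduct.apply_one {φ : FreeAlgebra ℂ (Fin k) →ₗ[ℂ] ℂ}
    {ψ : FreeAlgebra ℂ (Fin l) →ₗ[ℂ] ℂ} {τ} (h : IsFreeProduct φ ψ τ) (hφ : φ 1 = 1) :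
    τ 1 = 1 := by
  rw [← hφ, ← h.1, map_one (inclX k l)]

theorem IsFreeProduct.unique {φ : FreeAlgebra ℂ (Fin k) →ₗ[ℂ] ℂ}
    {ψ : FreeAlgebra ℂ (Fin l) →ₗ[ℂ] ℂ} {τ τ'} (h : IsFreeProduct φ ψ τ)
    (h' : IsFreeProduct φ ψ τ') (hφ : φ 1 = 1) : τ = τ' := by
  refine eq_of_isFree (h.apply_one hφ) h.2.2 h'.2.2 fun c x hx => ?_
  fin_cases c
  · obtain ⟨a, rfl⟩ := hx
    exact (h.1 a).trans (h'.1 a).symm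
  · obtain ⟨a, rfl⟩ := hx
    exact (h.2.1 a).trans (h'.2.1 a).symm

theorem isFreeProduct_freeProduct {φ : FreeAlgebra ℂ (Fin k) →ₗ[ℂ] ℂ}
    {ψ : FreeAlgebra ℂ (Fin l) →ₗ[ℂ] ℂ} (hφ : φ 1 = 1) (hψ : ψ 1 = 1) :
    IsFreeProduct φ ψ (freeProduct φ ψ) :=
  Classical.epsilon_spec (exists_isFreeProduct φ ψ hφ hψ)

theorem IsFreeProduct.apply_mul_comm {φ : FreeAlgebra ℂ (Fin k) →ₗ[ℂ] ℂ}
    {ψ : FreeAlgebra ℂ (Fin l) →ₗ[ℂ] ℂ} {τ} (h : IsFreeProduct φ ψ τ) (hφ : φ 1 = 1)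
    (hφt : ∀ x y, φ (x * y) = φ (y * x)) (hψt : ∀ x y, ψ (x * y) = ψ (y * x)) (c : Fin 2) {x}
    (hx : x ∈ subalgXY k l c) (P) : τ (x * P) = τ (P * x) := by
  have h1 := h.apply_one hφ
  refine h.2.2.apply_mul_comm h1 (fun c x hx y hy => ?_) hx
    (by rw [centeredSpan_eq_top h1]; trivial)
  fin_cases c
  · obtain ⟨a, rfl⟩ := hx
    obtain ⟨b, rfl⟩ := hy
    have := hφt a b
    rw [← h.1, ← h.1, map_mul (inclX k l), map_mul (inclX k l)] at this
    exact this
  · obtain ⟨a, rfl⟩ := hx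
    obtain ⟨b, rfl⟩ := hy
    have := hψt a b
    rw [← h.2.1, ← h.2.1, map_mul (inclY k l), map_mul (inclY k l)] at this
    exact this

/-! ### The free difference quotient -/

/-- The homomorphism `P ↦ !![P ⊗ 1, ∂P; 0, 1 ⊗ P]`, where `∂` is the free difference quotient of
the infinitesimal conjugation of the variables `Y`. -/
def dqHom (k l : ℕ) : FreeAlgebra ℂ (Fin k ⊕ Fin l) →ₐ[ℂ] Matrix (Fin 2) (Fin 2)
    (FreeAlgebra ℂ (Fin k ⊕ Fin l) ⊗[ℂ] FreeAlgebra ℂ (Fin k ⊕ Fin l)) :=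
  FreeAlgebra.lift ℂ fun x => !![FreeAlgebra.ι ℂ x ⊗ₜ 1,
    Sum.elim (fun _ => 0) (fun _ => 1 ⊗ₜ FreeAlgebra.ι ℂ x - FreeAlgebra.ι ℂ x ⊗ₜ 1) x;
    0, 1 ⊗ₜ FreeAlgebra.ι ℂ x]

/-- The derivation `∂` with `∂X = 0` and `∂Y = 1 ⊗ Y - Y ⊗ 1`. -/
def dq (k l : ℕ) : FreeAlgebra ℂ (Fin k ⊕ Fin l) →ₗ[ℂ]
    FreeAlgebra ℂ (Fin k ⊕ Fin l) ⊗[ℂ] FreeAlgebra ℂ (Fin k ⊕ Fin l) :=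
  Matrix.entryLinearMap ℂ _ 0 1 ∘ₗ (dqHom k l).toLinearMap

theorem dqHom_apply (P : FreeAlgebra ℂ (Fin k ⊕ Fin l)) :
    dqHom k l P = !![P ⊗ₜ 1, dq k l P; 0, 1 ⊗ₜ P] := by
  have h : dqHom k l P 0 0 = P ⊗ₜ 1 ∧ dqHom k l P 1 0 = 0 ∧ dqHom k l P 1 1 = 1 ⊗ₜ P := by
    induction P using FreeAlgebra.induction with
    | grade0 r =>
      simp [Algebra.algebraMap_eq_smul_one, Algebra.TensorProduct.one_def,
        TensorProduct.smul_tmul']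
    | grade1 x => simp [dqHom]
    | mul a b ha hb => simp [Matrix.mul_apply, Fin.sum_univ_two, ha, hb]
    | add a b ha hb => simp [ha, hb, TensorProduct.add_tmul, TensorProduct.tmul_add]
  ext i j
  fin_cases i <;> fin_cases j
  · exact h.1
  · rfl
  · exact h.2.1
  · exact h.2.2

/-- The Leibniz rule is the upper right entry of the multiplicativity of the triangular matrix
`dqHom`. -/
theorem dq_mul (P Q : FreeAlgebra ℂ (Fin k ⊕ Fin l)) :
    dq k l (P * Q) = (P ⊗ₜ 1) * dq k l Q + dq k l P * (1 ⊗ₜ Q) := by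
  have h := congr_fun (congr_fun (map_mul (dqHom k l) P Q) 0) 1
  rw [Matrix.mul_apply, Fin.sum_univ_two, dqHom_apply, dqHom_apply, dqHom_apply] at h
  simpa using h

@[simp] theorem dq_algebraMap (r : ℂ) : dq k l (algebraMap ℂ _ r) = 0 := by
  simp [dq, Matrix.algebraMap_matrix_apply]

@[simp] theorem dq_one : dq k l 1 = 0 := by
  simpa using dq_algebraMap (k := k) (l := l) 1

@[simp] theorem dq_ι_inl (i : Fin k) : dq k l (FreeAlgebra.ι ℂ (Sum.inl i)) = 0 := by
  simp [dq, dqHom]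

@[simp] theorem dq_ι_inr (j : Fin l) : dq k l (FreeAlgebra.ι ℂ (Sum.inr j)) =
    1 ⊗ₜ FreeAlgebra.ι ℂ (Sum.inr j) - FreeAlgebra.ι ℂ (Sum.inr j) ⊗ₜ 1 := by
  simp [dq, dqHom]

@[simp] theorem dq_inclX (a : FreeAlgebra ℂ (Fin k)) : dq k l (inclX k l a) = 0 := by
  induction a using FreeAlgebra.induction with
  | grade0 r => simp
  | grade1 i => simp
  | mul a b ha hb => rw [map_mul, dq_mul, ha, hb]; simp
  | add a b ha hb => rw [map_add, map_add, ha, hb]; simp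

theorem dq_inclY (b : FreeAlgebra ℂ (Fin l)) :
    dq k l (inclY k l b) = 1 ⊗ₜ inclY k l b - inclY k l b ⊗ₜ 1 := by
  induction b using FreeAlgebra.induction with
  | grade0 r =>
    simp [Algebra.algebraMap_eq_smul_one, TensorProduct.smul_tmul]
  | grade1 i => simp
  | mul a b ha hb => rw [map_mul, dq_mul, ha, hb]; simp [mul_sub, sub_mul]
  | add a b ha hb =>
    rw [map_add, map_add, ha, hb, TensorProduct.add_tmul, TensorProduct.tmul_add]; abel

/-- The linear extension of `P ⊗ Q ↦ T P * T Q`. -/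
def tensorSq {𝒞 : Type*} [CommRing 𝒞] [Algebra ℂ 𝒞] (T : FreeAlgebra ℂ (Fin k ⊕ Fin l) →ₗ[ℂ] 𝒞) :
    FreeAlgebra ℂ (Fin k ⊕ Fin l) ⊗[ℂ] FreeAlgebra ℂ (Fin k ⊕ Fin l) →ₗ[ℂ] 𝒞 :=
  LinearMap.mul' ℂ 𝒞 ∘ₗ TensorProduct.map T T

@[simp] theorem tensorSq_tmul {𝒞 : Type*} [CommRing 𝒞] [Algebra ℂ 𝒞]
    (T : FreeAlgebra ℂ (Fin k ⊕ Fin l) →ₗ[ℂ] 𝒞) (P Q) : tensorSq T (P ⊗ₜ Q) = T P * T Q := by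
  simp [tensorSq]

/-- A free functional is a fixed point of the loop equation. -/
theorem tensorSq_dq_eq_zero {τ : FreeAlgebra ℂ (Fin k ⊕ Fin l) →ₗ[ℂ] ℂ} (h1 : τ 1 = 1)
    (hτ : IsFree (subalgXY k l) τ) (P) : tensorSq τ (dq k l P) = 0 := by
  have hP : P ∈ centeredSpan (subalgXY k l) τ := by rw [centeredSpan_eq_top h1]; trivial
  induction hP using Submodule.span_induction with
  | zero => simp
  | add y z _ _ hy hz => rw [map_add, map_add, hy, hz, add_zero]
  | smul r y _ hy => rw [map_smul, map_smul, hy, smul_zero]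
  | mem y hy =>
    obtain ⟨L, hL, rfl⟩ := hy
    -- The value of `τ ⊗ τ` on a cut word does not depend on where the cut is made.
    have hzero : ∀ L₁ L₂, L = L₁ ++ L₂ → τ (wordProd L₁) * τ (wordProd L₂) =
        if L = [] then 1 else 0 := by
      rintro L₁ L₂ rfl
      by_cases h₁ : L₁ = []
      · by_cases h₂ : L₂ = []
        · simp [h₁, h₂, h1]
        · rw [hτ.apply_wordProd hL.right h₂]; simp [h₂]
      · rw [hτ.apply_wordProd hL.left h₁]; simp [h₁]
    -- Leibniz expansion with an accumulated prefix `L₁`. A letter from `ℂ⟨X⟩` contributes nothing;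
    -- a letter from `ℂ⟨Y⟩` contributes the difference of the cuts just before and just after it,
    -- which cancels by `hzero`.
    have key : ∀ L₁ L₂, L = L₁ ++ L₂ →
        tensorSq τ ((wordProd L₁ ⊗ₜ 1) * dq k l (wordProd L₂)) = 0 := by
      intro L₁ L₂ h
      induction L₂ generalizing L₁ with
      | nil => simp
      | cons x L₂ ih =>
        have hx := (hL.2 x (by simp [h])).1
        rw [wordProd_cons, dq_mul, mul_add, map_add, ← mul_assoc,
          Algebra.TensorProduct.tmul_mul_tmul, one_mul]
        have h₁ := ih (L₁ ++ [x]) (by simp [h])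
        simp only [wordProd_append, wordProd_cons, wordProd_nil, mul_one] at h₁
        rw [h₁, zero_add]
        obtain ⟨c, x⟩ := x
        fin_cases c
        · obtain ⟨a, rfl⟩ := hx
          simp
        · obtain ⟨b, rfl⟩ := hx
          have e1 : τ (wordProd L₁) * τ (inclY k l b * wordProd L₂) =
              if L = [] then 1 else 0 := by
            rw [← hzero L₁ _ h, wordProd_cons]
            rfl
          have e2 := hzero (L₁ ++ [(1, inclY k l b)]) L₂ (by simp [h])
          simp only [wordProd_append, wordProd_cons, wordProd_nil, mul_one] at e2
          simp [dq_inclY, mul_sub, sub_mul, e1, e2]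
    have h := key [] L rfl
    rwa [wordProd_nil, ← Algebra.TensorProduct.one_def, one_mul] at h

end FreeProduct

/-! ### Words and the loop equation -/

section Words

/-- All the ways to single out an entry of a list: the triples `(p, x, s)` with
`l = p ++ x :: s`. -/
def cuts {α : Type*} : List α → List (List α × α × List α)
  | [] => []
  | x :: l => ([], x, l) :: (cuts l).map fun t => (x :: t.1, t.2.1, t.2.2)

theorem eq_of_mem_cuts {α : Type*} {l : List α} {t} (ht : t ∈ cuts l) :
    l = t.1 ++ t.2.1 :: t.2.2 := by
  induction l generalizing t with
  | nil => simp [cuts] at ht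
  | cons x l ih =>
    rcases List.mem_cons.1 ht with rfl | ht
    · rfl
    · obtain ⟨r, hr, rfl⟩ := List.mem_map.1 ht
      simpa using ih hr

theorem cuts_map {α β : Type*} (f : α → β) (l : List α) :
    cuts (l.map f) = (cuts l).map fun t => (t.1.map f, f t.2.1, t.2.2.map f) := by
  induction l with
  | nil => rfl
  | cons x l ih => simp [cuts, ih, Function.comp_def]

variable {k l : ℕ}

/-- A letter `(b, a)` stands for the product of `b ∈ ℂ⟨Y⟩` and `a ∈ ℂ⟨X⟩`. -/
abbrev Letter (k l : ℕ) := FreeAlgebra ℂ (Fin l) × FreeAlgebra ℂ (Fin k)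

/-- The non-commutative polynomial `b₁ a₁ ⋯ bₙ aₙ` of a word of letters. -/
def wordEval (w : List (Letter k l)) : FreeAlgebra ℂ (Fin k ⊕ Fin l) :=
  (w.map fun c => inclY k l c.1 * inclX k l c.2).prod

@[simp] theorem wordEval_nil : wordEval ([] : List (Letter k l)) = 1 := rfl

@[simp] theorem wordEval_cons (c : Letter k l) (w) :
    wordEval (c :: w) = inclY k l c.1 * inclX k l c.2 * wordEval w := by simp [wordEval]

@[simp] theorem wordEval_append (v w : List (Letter k l)) :
    wordEval (v ++ w) = wordEval v * wordEval w := by simp [wordEval]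

/-- Each letter `b a` contributes the cut before `b` minus the cut between `b` and `a`. The first
kind keeps letters whole; the second opens one letter. -/
theorem dq_wordEval (w : List (Letter k l)) : dq k l (wordEval w) =
    ((cuts w).map fun t => wordEval t.1 ⊗ₜ[ℂ] wordEval (t.2.1 :: t.2.2) -
      (wordEval t.1 * inclY k l t.2.1.1) ⊗ₜ[ℂ] (inclX k l t.2.1.2 * wordEval t.2.2)).sum := by
  induction w with
  | nil => simp [cuts]
  | cons c w ih =>
    rw [wordEval_cons, dq_mul, dq_mul, dq_inclX, dq_inclY, ih, ← List.sum_map_mul_left]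
    simp only [cuts, List.map_cons, List.sum_cons, List.map_map, Function.comp_def, wordEval_nil,
      one_mul, mul_zero, zero_add, wordEval_cons]
    rw [add_comm]
    congr 1
    · simp [sub_mul, mul_assoc]
    · congr 1
      simp [mul_sub, mul_assoc]

theorem span_range_wordEval : Submodule.span ℂ (Set.range (wordEval (k := k) (l := l))) = ⊤ := by
  refine eq_top_iff.2 fun P _ => ?_
  induction P using FreeAlgebra.induction with
  | grade0 r =>
    rw [Algebra.algebraMap_eq_smul_one]
    exact Submodule.smul_mem _ _ (Submodule.subset_span ⟨[], rfl⟩)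
  | grade1 x =>
    rcases x with i | j
    · exact Submodule.subset_span ⟨[(1, FreeAlgebra.ι ℂ i)], by simp⟩
    · exact Submodule.subset_span ⟨[(FreeAlgebra.ι ℂ j, 1)], by simp⟩
  | mul a b ha hb =>
    have := Submodule.mul_mem_mul (ha trivial) (hb trivial)
    rw [Submodule.span_mul_span] at this
    refine Submodule.span_mono ?_ this
    rintro _ ⟨_, ⟨v, rfl⟩, _, ⟨w, rfl⟩, rfl⟩
    exact ⟨v ++ w, by simp⟩
  | add a b ha hb => exact add_mem (ha trivial) (hb trivial)

/-- Multiplication of the first letter of a word by an element of `ℂ⟨Y⟩` from the left. -/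
def mulHead (b : FreeAlgebra ℂ (Fin l)) : List (Letter k l) → List (Letter k l)
  | [] => []
  | c :: w => (b * c.1, c.2) :: w

/-- Multiplication of the last letter of a word by an element of `ℂ⟨X⟩` from the right. -/
def mulLast (a : FreeAlgebra ℂ (Fin k)) : List (Letter k l) → List (Letter k l)
  | [] => []
  | [c] => [(c.1, c.2 * a)]
  | c :: c' :: w => c :: mulLast a (c' :: w)

@[simp] theorem length_mulHead (b) (w : List (Letter k l)) : (mulHead b w).length = w.length := by
  cases w <;> rfl

@[simp] theorem length_mulLast (a) : ∀ w : List (Letter k l), (mulLast a w).length = w.length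
  | [] => rfl
  | [_] => rfl
  | _ :: c' :: w => by simp [mulLast, length_mulLast a (c' :: w)]

theorem wordEval_mulHead (b) {w : List (Letter k l)} (hw : w ≠ []) :
    wordEval (mulHead b w) = inclY k l b * wordEval w := by
  cases w with
  | nil => exact absurd rfl hw
  | cons c w => simp [mulHead, mul_assoc]

theorem wordEval_mulLast (a) : ∀ {w : List (Letter k l)}, w ≠ [] →
    wordEval (mulLast a w) = wordEval w * inclX k l a
  | [], hw => absurd rfl hw
  | [_], _ => by simp [mulLast, mul_assoc]
  | _ :: c' :: w, _ => by
    rw [mulLast, wordEval_cons, wordEval_mulLast a (List.cons_ne_nil c' w),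
      wordEval_cons (w := c' :: w)]
    simp only [mul_assoc]

theorem ne_nil_of_length_eq {α β : Type*} {v : List α} {w : List β} (h : v.length = w.length)
    (hw : w ≠ []) : v ≠ [] := by
  rintro rfl
  exact hw (List.length_eq_zero_iff.1 h.symm)

/-! ### Moment families and the loop equation -/

/-- The linear laws of a joint moment functional `(Q₁, …, Q_r) ↦ E(T(Q₁) ⋯ T(Q_r))` with `T`
tracial and deterministic on `ℂ⟨X⟩` and `ℂ⟨Y⟩`. -/
structure IsMomentFamily (φ : FreeAlgebra ℂ (Fin k) →ₗ[ℂ] ℂ) (ψ : FreeAlgebra ℂ (Fin l) →ₗ[ℂ] ℂ)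
    (m : List (FreeAlgebra ℂ (Fin k ⊕ Fin l)) → ℂ) : Prop where
  perm : ∀ {Qs Qs'}, Qs.Perm Qs' → m Qs = m Qs'
  one : ∀ Qs, m (1 :: Qs) = m Qs
  scalarX : ∀ a Qs, m (inclX k l a :: Qs) = φ a * m Qs
  scalarY : ∀ b Qs, m (inclY k l b :: Qs) = ψ b * m Qs
  cycX : ∀ a P Qs, m (inclX k l a * P :: Qs) = m (P * inclX k l a :: Qs)
  cycY : ∀ b P Qs, m (inclY k l b * P :: Qs) = m (P * inclY k l b :: Qs)

/-- The loop (Schwinger–Dyson) equation with parameter `ε`, together with the linear laws. -/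
structure LoopEq (φ : FreeAlgebra ℂ (Fin k) →ₗ[ℂ] ℂ) (ψ : FreeAlgebra ℂ (Fin l) →ₗ[ℂ] ℂ)
    (ε : ℂ) (m : List (FreeAlgebra ℂ (Fin k ⊕ Fin l)) → ℂ) : Prop
    extends IsMomentFamily φ ψ m where
  nil : m [] = 1
  loop : ∀ (w : List (Letter k l)) (Ws : List (List (Letter k l))),
    ((cuts w).map fun t =>
      m (wordEval t.1 :: wordEval (t.2.1 :: t.2.2) :: Ws.map wordEval) -
      m (wordEval t.1 * inclY k l t.2.1.1 :: inclX k l t.2.1.2 * wordEval t.2.2 ::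
        Ws.map wordEval)).sum +
    ε * ((cuts Ws).map fun t => ((cuts t.2.1).map fun r =>
      m (t.1.map wordEval ++ wordEval r.1 * wordEval w * wordEval (r.2.1 :: r.2.2) ::
        t.2.2.map wordEval) -
      m (t.1.map wordEval ++ wordEval r.1 * inclY k l r.2.1.1 * wordEval w *
        (inclX k l r.2.1.2 * wordEval r.2.2) :: t.2.2.map wordEval)).sum).sum = 0

/-- The linear extension of `x ⊗ y ↦ x * P * y`. -/
def insertion (P : FreeAlgebra ℂ (Fin k ⊕ Fin l)) :
    FreeAlgebra ℂ (Fin k ⊕ Fin l) ⊗[ℂ] FreeAlgebra ℂ (Fin k ⊕ Fin l) →ₗ[ℂ]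
      FreeAlgebra ℂ (Fin k ⊕ Fin l) :=
  LinearMap.mul' ℂ _ ∘ₗ TensorProduct.map (LinearMap.mulRight ℂ P) LinearMap.id

@[simp] theorem insertion_tmul (P x y : FreeAlgebra ℂ (Fin k ⊕ Fin l)) :
    insertion P (x ⊗ₜ y) = x * P * y := by simp [insertion]

/-- One criterion serves both solutions: `T` plays the role of a random trace with values in a
commutative algebra and `E` that of the expectation. For the free product `T` is scalar-valued and
`E` is the identity. -/
theorem loopEq_of_dq {φ : FreeAlgebra ℂ (Fin k) →ₗ[ℂ] ℂ} {ψ : FreeAlgebra ℂ (Fin l) →ₗ[ℂ] ℂ}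
    {𝒞 : Type*} [CommRing 𝒞] [Algebra ℂ 𝒞] (T : FreeAlgebra ℂ (Fin k ⊕ Fin l) →ₗ[ℂ] 𝒞)
    (E : 𝒞 →ₗ[ℂ] ℂ) (ε : ℂ) (hE : E 1 = 1) (hT : T 1 = 1)
    (hX : ∀ a, T (inclX k l a) = algebraMap ℂ 𝒞 (φ a))
    (hY : ∀ b, T (inclY k l b) = algebraMap ℂ 𝒞 (ψ b))
    (hXc : ∀ a P, T (inclX k l a * P) = T (P * inclX k l a))
    (hYc : ∀ b P, T (inclY k l b * P) = T (P * inclY k l b))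
    (hloop : ∀ P Qs, E (tensorSq T (dq k l P) * (Qs.map T).prod) +
      ε * ((cuts Qs).map fun t => E ((t.1.map T).prod *
        (T (insertion P (dq k l t.2.1)) * (t.2.2.map T).prod))).sum = 0) :
    LoopEq φ ψ ε fun Qs => E (Qs.map T).prod where
  perm h := by rw [(h.map T).prod_eq]
  one Qs := by simp [hT]
  scalarX a Qs := by simp [hX, ← Algebra.smul_def]
  scalarY a Qs := by simp [hY, ← Algebra.smul_def]
  cycX a P Qs := by simp [hXc]
  cycY a P Qs := by simp [hYc]
  nil := by simp [hE]
  loop w Ws := by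
    have h := hloop (wordEval w) (Ws.map wordEval)
    rw [dq_wordEval, map_list_sum, List.map_map, ← List.sum_map_mul_right, map_list_sum,
      List.map_map, cuts_map, List.map_map (l := cuts Ws)] at h
    rw [← h]
    congr 1
    · congr 1
      refine List.map_congr_left fun t _ => ?_
      simp only [Function.comp_apply, map_sub, tensorSq_tmul, List.map_cons, List.prod_cons,
        sub_mul, mul_assoc, List.map_map]
    · congr 2
      refine List.map_congr_left fun t _ => ?_
      simp only [Function.comp_apply]
      rw [dq_wordEval, map_list_sum, List.map_map, map_list_sum, List.map_map,
        ← List.sum_map_mul_right, ← List.sum_map_mul_left, map_list_sum]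
      simp only [List.map_map]
      congr 1
      refine List.map_congr_left fun r _ => ?_
      simp only [Function.comp_apply, map_sub, insertion_tmul, List.map_append, List.map_cons,
        List.prod_append, List.prod_cons, sub_mul, mul_sub, List.map_map]

variable {φ : FreeAlgebra ℂ (Fin k) →ₗ[ℂ] ℂ} {ψ : FreeAlgebra ℂ (Fin l) →ₗ[ℂ] ℂ}

theorem IsFreeProduct.loopEq {τ} (h : IsFreeProduct φ ψ τ) (hφ : φ 1 = 1)
    (hφt : ∀ x y, φ (x * y) = φ (y * x)) (hψt : ∀ x y, ψ (x * y) = ψ (y * x)) :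
    LoopEq φ ψ 0 fun Qs => (Qs.map τ).prod := by
  refine loopEq_of_dq τ LinearMap.id 0 rfl (h.apply_one hφ) h.1 h.2.1
    (fun a P => h.apply_mul_comm hφ hφt hψt 0 (inclX_mem a) P)
    (fun b P => h.apply_mul_comm hφ hφt hψt 1 (inclY_mem b) P) fun P Qs => ?_
  rw [tensorSq_dq_eq_zero (h.apply_one hφ) h.2.2]
  simp

/-- The loop equation, solved for the term in which nothing is split off. -/
theorem LoopEq.apply_cons {ε : ℂ} {m : List (FreeAlgebra ℂ (Fin k ⊕ Fin l)) → ℂ}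
    (h : LoopEq φ ψ ε m) (c : Letter k l) (s : List (Letter k l)) (Ws) :
    m (((c :: s) :: Ws).map wordEval) =
      m (inclY k l c.1 :: inclX k l c.2 * wordEval s :: Ws.map wordEval) -
      ((cuts s).map fun t =>
        m (((c :: t.1) :: (t.2.1 :: t.2.2) :: Ws).map wordEval) -
        m (wordEval (c :: t.1) * inclY k l t.2.1.1 :: inclX k l t.2.1.2 * wordEval t.2.2 ::
          Ws.map wordEval)).sum -
      ε * ((cuts Ws).map fun t => ((cuts t.2.1).map fun r =>
        m ((t.1 ++ (r.1 ++ (c :: s) ++ r.2.1 :: r.2.2) :: t.2.2).map wordEval) -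
        m ((t.1 ++ (r.1 ++ mulHead r.2.1.1 (mulLast r.2.1.2 (c :: s)) ++ r.2.2) ::
          t.2.2).map wordEval)).sum).sum := by
  -- The cut in front of the first letter has an empty prefix, so it returns the moment of the uncut
  -- word; this is the term solved for.
  have h1 := h.loop (c :: s) Ws
  simp only [cuts, List.map_cons, List.sum_cons, List.map_map, Function.comp_def,
    wordEval_nil, one_mul, h.one] at h1
  -- An inserted word at an opened letter absorbs its two halves into its own first and last
  -- letters, so the number of letters drops by one.
  have h2 : ∀ r : List (Letter k l) × Letter k l × List (Letter k l),
      wordEval (r.1 ++ mulHead r.2.1.1 (mulLast r.2.1.2 (c :: s)) ++ r.2.2) =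
      wordEval r.1 * inclY k l r.2.1.1 * wordEval (c :: s) *
        (inclX k l r.2.1.2 * wordEval r.2.2) := by
    intro r
    rw [wordEval_append, wordEval_append, wordEval_mulHead _
      (ne_nil_of_length_eq (length_mulLast _ _) (by simp)), wordEval_mulLast _ (by simp)]
    simp only [mul_assoc]
  simp only [List.map_append, List.map_cons, h2]
  simp only [wordEval_append]
  linear_combination h1

end Words

/-! ### Asymptotics of solutions of the loop equation -/

section Asymptotics

variable {k l : ℕ} {ι : Type*} {F : Filter ι}
  {φ : ι → FreeAlgebra ℂ (Fin k) →ₗ[ℂ] ℂ} {ψ : ι → FreeAlgebra ℂ (Fin l) →ₗ[ℂ] ℂ}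

theorem list_sum_map_sub {α : Type*} (L : List α) (f g : α → ℂ) :
    (L.map fun t => f t - g t).sum = (L.map f).sum - (L.map g).sum := by
  induction L with
  | nil => simp
  | cons a L ih => simp only [List.map_cons, List.sum_cons, ih]; ring

theorem isBigO_list_sum {α : Type*} {g : ι → ℝ} {L : List α} {f : α → ι → ℂ}
    (h : ∀ t ∈ L, f t =O[F] g) : (fun x => (L.map fun t => f t x).sum) =O[F] g := by
  induction L with
  | nil => simpa using isBigO_zero g F
  | cons a L ih =>
    simp only [List.map_cons, List.sum_cons]
    exact (h a (by simp)).add (ih fun t ht => h t (by simp [ht]))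

theorem bounded_mul_isBigO {c f : ι → ℂ} {g : ι → ℝ} (hc : c =O[F] fun _ => (1 : ℝ))
    (hf : f =O[F] g) : (fun x => c x * f x) =O[F] g := by
  simpa using hc.mul hf

/-! ### Estimates by induction on the number of letters -/

/-- The total number of letters of a list of words. -/
def size (Ws : List (List (Letter k l))) : ℕ := (Ws.map List.length).sum

@[simp] theorem size_cons (w) (Ws : List (List (Letter k l))) :
    size (w :: Ws) = w.length + size Ws := by simp [size]

@[simp] theorem size_append (Vs Ws : List (List (Letter k l))) :
    size (Vs ++ Ws) = size Vs + size Ws := by simp [size]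

/-- The lists of non-empty words with letters in `S` and `n` letters in total. -/
def configs (S : Set (Letter k l)) (n : ℕ) : Set (List (List (Letter k l))) :=
  {Ws | (∀ w ∈ Ws, w ≠ [] ∧ ∀ c ∈ w, c ∈ S) ∧ size Ws = n}

theorem mem_configs_cons {S : Set (Letter k l)} {n : ℕ} {w Ws} :
    w :: Ws ∈ configs S n ↔ (w ≠ [] ∧ ∀ c ∈ w, c ∈ S) ∧
      (∀ w ∈ Ws, w ≠ [] ∧ ∀ c ∈ w, c ∈ S) ∧ w.length + size Ws = n := by
  simp [configs, and_assoc]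

theorem length_le_of_mem_configs {S : Set (Letter k l)} {n : ℕ} {Ws}
    (h : Ws ∈ configs S n) : Ws.length ≤ n := by
  rw [← h.2]
  replace h := h.1
  induction Ws with
  | nil => simp
  | cons w Ws ih =>
    have := ih fun w hw => h w (by simp [hw])
    have h1 := List.length_pos_iff.2 (h w (by simp)).1
    simp only [List.length_cons, size_cons]
    omega

theorem finite_lists {α : Type*} {s : Set α} (hs : s.Finite) (n : ℕ) :
    {L : List α | (∀ x ∈ L, x ∈ s) ∧ L.length ≤ n}.Finite := by
  have := hs.to_subtype
  refine ((List.finite_length_le s n).image (List.map Subtype.val)).subset ?_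
  rintro L ⟨hL, hn⟩
  lift L to List s using hL
  exact ⟨L, by simpa using hn, rfl⟩

theorem length_le_size {w : List (Letter k l)} {Ws} (h : w ∈ Ws) : w.length ≤ size Ws :=
  List.le_sum_of_mem (List.mem_map.2 ⟨w, h, rfl⟩)

theorem finite_configs {S : Set (Letter k l)} (hS : S.Finite) (n : ℕ) : (configs S n).Finite :=
  (finite_lists (finite_lists hS n) n).subset fun _ hW =>
    ⟨fun w hw => ⟨(hW.1 w hw).2, hW.2 ▸ length_le_size hw⟩, length_le_of_mem_configs hW⟩

/-- Reduction of moments in which a word has been opened to moments of shorter words. -/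
theorem isBigO_split {h : ι → List (FreeAlgebra ℂ (Fin k ⊕ Fin l)) → ℂ}
    (hh : ∀ x, IsMomentFamily (φ x) (ψ x) (h x))
    (hφ : ∀ a, (fun x => φ x a) =O[F] fun _ => (1 : ℝ))
    (hψ : ∀ b, (fun x => ψ x b) =O[F] fun _ => (1 : ℝ)) {g : ι → ℝ} {n : ℕ}
    (hlow : ∀ m < n, ∀ Ws ∈ configs Set.univ m, (fun x => h x (Ws.map wordEval)) =O[F] g)
    (p s : List (Letter k l)) (b : FreeAlgebra ℂ (Fin l)) (a : FreeAlgebra ℂ (Fin k))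
    {Ws : List (List (Letter k l))} (hne : ∀ w ∈ Ws, w ≠ [])
    (hn : p.length + s.length + size Ws < n) :
    (fun x => h x (wordEval p * inclY k l b :: inclX k l a * wordEval s :: Ws.map wordEval))
      =O[F] g := by
  have step : ∀ {Ws : List (List (Letter k l))}, (∀ w ∈ Ws, w ≠ []) → s.length + size Ws < n →
      (fun x => h x (inclX k l a * wordEval s :: Ws.map wordEval)) =O[F] g := by
    intro Ws hne hn
    by_cases hs : s = []
    · simp only [hs, wordEval_nil, mul_one, (hh _).scalarX]
      exact bounded_mul_isBigO (hφ a) (hlow (size Ws) (by omega) Ws ⟨by simpa using hne, rfl⟩)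
    · simp only [(hh _).cycX, ← wordEval_mulLast a hs]
      exact hlow _ (by simpa using hn) (mulLast a s :: Ws)
        ⟨by simpa using ⟨ne_nil_of_length_eq (length_mulLast a s) hs, hne⟩, rfl⟩
  by_cases hp : p = []
  · simp only [hp, wordEval_nil, one_mul, (hh _).scalarY]
    exact bounded_mul_isBigO (hψ b) (step hne (by omega))
  · simp only [← (hh _).cycY, ← wordEval_mulHead b hp]
    exact (step (Ws := mulHead b p :: Ws)
      (by simpa using ⟨ne_nil_of_length_eq (length_mulHead b p) hp, hne⟩)
      (by simp; omega)).congr_left fun x => (hh x).perm (List.Perm.swap _ _ _)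

/-- Solutions of the loop equation are controlled by the inhomogeneity. -/
theorem isBigO_of_loop {h : ι → List (FreeAlgebra ℂ (Fin k ⊕ Fin l)) → ℂ}
    (hh : ∀ x, IsMomentFamily (φ x) (ψ x) (h x))
    (hφ : ∀ a, (fun x => φ x a) =O[F] fun _ => (1 : ℝ))
    (hψ : ∀ b, (fun x => ψ x b) =O[F] fun _ => (1 : ℝ)) {g : ι → ℝ} {n : ℕ}
    (hlow : ∀ m < n, ∀ Ws ∈ configs Set.univ m, (fun x => h x (Ws.map wordEval)) =O[F] g)
    (hnil : (fun x => h x []) =O[F] g) (S : Set (Letter k l))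
    (R : Letter k l → List (Letter k l) → List (List (Letter k l)) → ι → ℂ)
    (hR : ∀ c s Ws, (c :: s) :: Ws ∈ configs S n → R c s Ws =O[F] g)
    (hrec : ∀ c s Ws, (c :: s) :: Ws ∈ configs S n → ∀ x,
      h x (((c :: s) :: Ws).map wordEval) =
      h x (inclY k l c.1 :: inclX k l c.2 * wordEval s :: Ws.map wordEval) -
      ((cuts s).map fun t =>
        h x (((c :: t.1) :: (t.2.1 :: t.2.2) :: Ws).map wordEval) -
        h x (wordEval (c :: t.1) * inclY k l t.2.1.1 :: inclX k l t.2.1.2 * wordEval t.2.2 ::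
          Ws.map wordEval)).sum - R c s Ws x)
    {Ws : List (List (Letter k l))} (hWs : Ws ∈ configs S n) :
    (fun x => h x (Ws.map wordEval)) =O[F] g := by
  -- Cutting between letters keeps the total `n` but adds a word. Non-empty words number at most
  -- `n`, so `n - Ws.length` decreases. Cuts through a letter lower the total and fall under `hlow`.
  induction hj : n - Ws.length using Nat.strong_induction_on generalizing Ws with
  | _ j ih =>
    subst hj
    rcases Ws with _ | ⟨_ | ⟨c, s⟩, Ws⟩
    · exact hnil
    · exact absurd rfl (hWs.1 [] (by simp)).1
    · have hW := mem_configs_cons.1 hWs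
      have hne : ∀ w ∈ Ws, w ≠ [] := fun w hw => (hW.2.1 w hw).1
      have hsize : s.length + 1 + size Ws = n := by simpa using hW.2.2
      simp only [hrec c s Ws hWs]
      refine ((?_ : _ =O[F] g).sub (isBigO_list_sum fun t ht => ?_)).sub (hR c s Ws hWs)
      · have := isBigO_split hh hφ hψ hlow [] s c.1 c.2 hne (by simp; omega)
        simpa using this
      · have hs := eq_of_mem_cuts ht
        have hlen : s.length = t.1.length + (t.2.2.length + 1) := by rw [hs]; simp
        refine (?_ : _ =O[F] g).sub ?_
        · have hmem : (c :: t.1) :: (t.2.1 :: t.2.2) :: Ws ∈ configs S n := by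
            have hc := hW.1.2
            rw [hs] at hc
            refine mem_configs_cons.2 ⟨⟨by simp, fun y hy => hc y ?_⟩,
              List.forall_mem_cons.2 ⟨⟨by simp, fun y hy => hc y ?_⟩, hW.2.1⟩, by simp; omega⟩
            · simp at hy ⊢; tauto
            · simp at hy ⊢; tauto
          have := length_le_of_mem_configs hmem
          exact ih _ (by simp at this ⊢; omega) hmem rfl
        · exact isBigO_split hh hφ hψ hlow (c :: t.1) t.2.2 _ _ hne (by simp; omega)

theorem IsMomentFamily.sub {φ : FreeAlgebra ℂ (Fin k) →ₗ[ℂ] ℂ} {ψ : FreeAlgebra ℂ (Fin l) →ₗ[ℂ] ℂ}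
    {m m' : List (FreeAlgebra ℂ (Fin k ⊕ Fin l)) → ℂ} (h : IsMomentFamily φ ψ m)
    (h' : IsMomentFamily φ ψ m') : IsMomentFamily φ ψ fun Qs => m Qs - m' Qs where
  perm hQ := by rw [h.perm hQ, h'.perm hQ]
  one Qs := by rw [h.one, h'.one]
  scalarX a Qs := by rw [h.scalarX, h'.scalarX, mul_sub]
  scalarY a Qs := by rw [h.scalarY, h'.scalarY, mul_sub]
  cycX a P Qs := by rw [h.cycX, h'.cycX]
  cycY a P Qs := by rw [h.cycY, h'.cycY]

/-- Solutions of the loop equation without correction term are bounded. -/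
theorem LoopEq.isBigO_one {m : ι → List (FreeAlgebra ℂ (Fin k ⊕ Fin l)) → ℂ}
    (hm : ∀ x, LoopEq (φ x) (ψ x) 0 (m x))
    (hφ : ∀ a, (fun x => φ x a) =O[F] fun _ => (1 : ℝ))
    (hψ : ∀ b, (fun x => ψ x b) =O[F] fun _ => (1 : ℝ)) {n : ℕ}
    {Ws : List (List (Letter k l))} (hWs : Ws ∈ configs Set.univ n) :
    (fun x => m x (Ws.map wordEval)) =O[F] fun _ => (1 : ℝ) := by
  induction n using Nat.strong_induction_on generalizing Ws with
  | _ n ih =>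
    refine isBigO_of_loop (fun x => (hm x).toIsMomentFamily) hφ hψ (fun j hj Ws hW => ih j hj hW)
      ?_ Set.univ (fun _ _ _ _ => 0) (fun _ _ _ _ => isBigO_zero _ _) (fun c s Ws _ x => ?_) hWs
    · simp only [(hm _).nil]
      exact isBigO_const_const _ one_ne_zero _
    · rw [(hm x).apply_cons, zero_mul]

/-- Once `C ‖ε‖ < 1/2`, the term `C ‖ε‖ Δ` is absorbed into the left side, which costs a factor `2`.
-/
theorem isBigO_of_isBigO_mul_one_add {ε : ι → ℂ} (hε : Tendsto ε F (𝓝 0)) {Δ : ι → ℝ}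
    (h0 : ∀ x, 0 ≤ Δ x) (h : Δ =O[F] fun x => ‖ε x‖ * (1 + Δ x)) : Δ =O[F] ε := by
  obtain ⟨C, hC, hb⟩ := h.exists_pos
  have h1 : ∀ᶠ x in F, C * ‖ε x‖ < 1 / 2 := by
    have : Tendsto (fun x => C * ‖ε x‖) F (𝓝 (C * ‖(0 : ℂ)‖)) := (hε.norm).const_mul C
    exact this.eventually (gt_mem_nhds (by simp))
  refine IsBigO.of_bound (2 * C) ?_
  filter_upwards [hb.bound, h1] with x hx h1
  have hp : 0 ≤ ‖ε x‖ * (1 + Δ x) := mul_nonneg (norm_nonneg _) (by linarith [h0 x])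
  rw [Real.norm_of_nonneg (h0 x)] at hx ⊢
  rw [Real.norm_of_nonneg hp] at hx
  nlinarith [h0 x]

/-- The solution of the loop equation with parameter `ε` is within `O(ε)` of the solution with
parameter `0`. -/
theorem LoopEq.sub_isBigO {m m' : ι → List (FreeAlgebra ℂ (Fin k ⊕ Fin l)) → ℂ} {ε : ι → ℂ}
    (hε : Tendsto ε F (𝓝 0))
    (hm : ∀ x, LoopEq (φ x) (ψ x) (ε x) (m x)) (hm' : ∀ x, LoopEq (φ x) (ψ x) 0 (m' x))
    (hφ : ∀ a, (fun x => φ x a) =O[F] fun _ => (1 : ℝ))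
    (hψ : ∀ b, (fun x => ψ x b) =O[F] fun _ => (1 : ℝ)) {n : ℕ}
    {Ws : List (List (Letter k l))} (hWs : Ws ∈ configs Set.univ n) :
    (fun x => m x (Ws.map wordEval) - m' x (Ws.map wordEval)) =O[F] ε := by
  induction n using Nat.strong_induction_on generalizing Ws with
  | _ n ih =>
    -- Restricting to the letters occurring in `Ws` leaves finitely many configurations of size `n`,
    -- so their discrepancies can be bounded jointly by the sum `Δ`.
    have hfin := finite_configs (List.finite_toSet Ws.flatten) n
    set S : Set (Letter k l) := {c | c ∈ Ws.flatten} with hS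
    have hmem : Ws ∈ configs S n :=
      ⟨fun w hw => ⟨(hWs.1 w hw).1, fun c hc => List.mem_flatten.2 ⟨w, hw, hc⟩⟩, hWs.2⟩
    let D : ι → List (FreeAlgebra ℂ (Fin k ⊕ Fin l)) → ℂ := fun x Qs => m x Qs - m' x Qs
    let Δ : ι → ℝ := fun x => ∑ V ∈ hfin.toFinset, ‖D x (V.map wordEval)‖
    have hΔ0 : ∀ x, 0 ≤ Δ x := fun x => Finset.sum_nonneg fun _ _ => norm_nonneg _
    have hΔ : ∀ V ∈ configs S n, ∀ x, ‖D x (V.map wordEval)‖ ≤ Δ x := fun V hV x =>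
      Finset.single_le_sum (f := fun V => ‖D x (V.map wordEval)‖) (fun _ _ => norm_nonneg _)
        (hfin.mem_toFinset.2 hV)
    have hone : (fun _ => (1 : ℝ)) =O[F] fun x => 1 + Δ x :=
      IsBigO.of_bound 1 (Eventually.of_forall fun x => by
        rw [norm_one, Real.norm_of_nonneg (by linarith [hΔ0 x])]; linarith [hΔ0 x])
    have honeC : (fun _ => (1 : ℂ)) =O[F] fun x => 1 + Δ x :=
      (isBigO_const_const (1 : ℂ) (one_ne_zero (α := ℝ)) F).trans hone
    have hεg : ε =O[F] fun x => ‖ε x‖ * (1 + Δ x) := by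
      simpa using (isBigO_refl ε F).norm_right.mul honeC
    have hε1 : ε =O[F] fun _ => (1 : ℝ) := hε.isBigO_one ℝ
    have hmain : ∀ {V}, V ∈ configs S n →
        (fun x => D x (V.map wordEval)) =O[F] fun x => ‖ε x‖ * (1 + Δ x) := by
      intro V hV
      refine isBigO_of_loop (fun x => (hm x).toIsMomentFamily.sub (hm' x).toIsMomentFamily) hφ hψ
        (fun j hj W hW => (ih j hj hW).trans hεg) ?_ S
        (fun c s Ws x => ε x * ((cuts Ws).map fun t => ((cuts t.2.1).map fun r =>
          m x ((t.1 ++ (r.1 ++ (c :: s) ++ r.2.1 :: r.2.2) :: t.2.2).map wordEval) -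
          m x ((t.1 ++ (r.1 ++ mulHead r.2.1.1 (mulLast r.2.1.2 (c :: s)) ++ r.2.2) ::
            t.2.2).map wordEval)).sum).sum) ?_ ?_ hV
      · simpa [(hm _).nil, (hm' _).nil] using isBigO_zero _ _
      · intro c s Ws hW
        refine (isBigO_refl ε F).norm_right.mul (isBigO_list_sum fun t ht =>
          isBigO_list_sum fun r hr => ?_)
        have hW' := mem_configs_cons.1 hW
        have hWs := eq_of_mem_cuts ht
        have ht2 := eq_of_mem_cuts hr
        have hsz := hW'.2.2
        rw [hWs, size_append, size_cons, ht2] at hsz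
        have hW1 := hW'.2.1
        rw [hWs, ht2] at hW1
        have hq := (hW1 (r.1 ++ r.2.1 :: r.2.2) (by simp)).2
        have hc := hW'.1.2
        -- A moment of `m` is the discrepancy plus a moment of `m'`, and the latter is bounded
        -- because `m'` solves the equation with parameter `0`.
        have key : ∀ {j} {V}, V ∈ configs Set.univ j →
            ((fun x => D x (V.map wordEval)) =O[F] fun x => 1 + Δ x) →
            (fun x => m x (V.map wordEval)) =O[F] fun x => 1 + Δ x := by
          intro j V hV hD
          have h2 := (LoopEq.isBigO_one hm' hφ hψ hV).trans hone
          simpa [D] using hD.add h2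
        refine (?_ : _ =O[F] fun x => 1 + Δ x).sub ?_
        -- Insertion between letters preserves the alphabet and the total size but lowers the number
        -- of words. The induction on words cannot handle it, so it is bounded by `Δ`.
        · have hV : t.1 ++ (r.1 ++ (c :: s) ++ r.2.1 :: r.2.2) :: t.2.2 ∈ configs S n := by
            refine ⟨fun w hw => ?_, by simp at hsz ⊢; omega⟩
            rcases List.mem_append.1 hw with hw | hw
            · exact hW1 w (by simp [hw])
            rcases List.mem_cons.1 hw with rfl | hw
            · refine ⟨by simp, fun y hy => ?_⟩
              simp only [List.mem_append] at hy hq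
              rcases hy with (hy | hy) | hy
              exacts [hq y (Or.inl hy), hc y hy, hq y (Or.inr hy)]
            · exact hW1 w (by simp [hw])
          refine key (j := n) ⟨fun w hw => ⟨(hV.1 w hw).1, fun _ _ => trivial⟩, hV.2⟩ ?_
          refine IsBigO.of_bound 1 (Eventually.of_forall fun x => ?_)
          rw [Real.norm_of_nonneg (by linarith [hΔ0 x])]
          linarith [hΔ _ hV x]
        -- Insertion at an opened letter creates letters possibly outside `S`, but has size `n - 1`.
        -- The outer induction, over all letters, covers it.
        · have hV : t.1 ++ (r.1 ++ mulHead r.2.1.1 (mulLast r.2.1.2 (c :: s)) ++ r.2.2) ::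
              t.2.2 ∈ configs Set.univ (n - 1) := by
            refine ⟨fun w hw => ⟨?_, fun _ _ => trivial⟩, by simp at hsz ⊢; omega⟩
            rcases List.mem_append.1 hw with hw | hw
            · exact (hW1 w (by simp [hw])).1
            rcases List.mem_cons.1 hw with rfl | hw
            · refine List.length_pos_iff.1 ?_
              simp
            · exact (hW1 w (by simp [hw])).1
          exact key hV (((ih (n - 1) (by simp at hsz; omega) hV).trans hε1).trans hone)
      · intro c s Ws _ x
        rw [(hm x).apply_cons, (hm' x).apply_cons]
        simp only [list_sum_map_sub]
        ring
    refine IsBigO.trans ?_ (isBigO_of_isBigO_mul_one_add hε hΔ0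
      (IsBigO.fun_sum fun V hV => (hmain (hfin.mem_toFinset.1 hV)).norm_left))
    exact IsBigO.of_bound 1 (Eventually.of_forall fun x => by
      rw [Real.norm_of_nonneg (hΔ0 x), one_mul]; exact hΔ Ws hmem x)

end Asymptotics

/-! ### The loop equation for Haar unitary matrices -/

section Haar

variable {N k l : ℕ}

/-- The evaluation of a non-commutative polynomial at `(A, u B u*)`. -/
def matEval (A : Fin k → Matrix (Fin N) (Fin N) ℂ) (B : Fin l → Matrix (Fin N) (Fin N) ℂ)
    (u : Matrix.unitaryGroup (Fin N) ℂ) :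
    FreeAlgebra ℂ (Fin k ⊕ Fin l) →ₐ[ℂ] Matrix (Fin N) (Fin N) ℂ :=
  FreeAlgebra.lift ℂ (Sum.elim A (conjTuple u B))

theorem jointDist_eq_normTr_matEval (A : Fin k → Matrix (Fin N) (Fin N) ℂ)
    (B : Fin l → Matrix (Fin N) (Fin N) ℂ) (u : Matrix.unitaryGroup (Fin N) ℂ) (P) :
    jointDist A (conjTuple u B) P = normTr N (matEval A B u P) := rfl

theorem matEval_inclX (A : Fin k → Matrix (Fin N) (Fin N) ℂ)
    (B : Fin l → Matrix (Fin N) (Fin N) ℂ) (u : Matrix.unitaryGroup (Fin N) ℂ) (a) :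
    matEval A B u (inclX k l a) = FreeAlgebra.lift ℂ A a := by
  have : (matEval A B u).comp (inclX k l) = FreeAlgebra.lift ℂ A := by ext i : 2; simp [matEval]
  exact DFunLike.congr_fun this a

theorem matEval_inclY (A : Fin k → Matrix (Fin N) (Fin N) ℂ)
    (B : Fin l → Matrix (Fin N) (Fin N) ℂ) (u : Matrix.unitaryGroup (Fin N) ℂ) (b) :
    matEval A B u (inclY k l b) = (u : Matrix (Fin N) (Fin N) ℂ) * FreeAlgebra.lift ℂ B b *
      star (u : Matrix (Fin N) (Fin N) ℂ) := by
  have hu : star (u : Matrix (Fin N) (Fin N) ℂ) * u = 1 := Unitary.coe_star_mul_self u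
  have hu' : (u : Matrix (Fin N) (Fin N) ℂ) * star (u : Matrix (Fin N) (Fin N) ℂ) = 1 :=
    Unitary.coe_mul_star_self u
  induction b using FreeAlgebra.induction with
  | grade0 r => simp [Algebra.algebraMap_eq_smul_one, hu']
  | grade1 i => simp [matEval, conjTuple]
  | mul a b ha hb =>
    rw [map_mul, map_mul, ha, hb, map_mul]
    calc _ = (u : Matrix (Fin N) (Fin N) ℂ) * FreeAlgebra.lift ℂ B a *
          (star (u : Matrix (Fin N) (Fin N) ℂ) * u) * FreeAlgebra.lift ℂ B b *
          star (u : Matrix (Fin N) (Fin N) ℂ) := by simp only [mul_assoc]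
      _ = _ := by rw [hu]; simp only [mul_assoc, mul_one]
  | add a b ha hb => rw [map_add, map_add, ha, hb, map_add, mul_add, add_mul]

theorem normTr_mul_comm (M M' : Matrix (Fin N) (Fin N) ℂ) :
    normTr N (M * M') = normTr N (M' * M) := by
  simp [normTr, Matrix.trace_mul_comm M M']

theorem normTr_apply (M : Matrix (Fin N) (Fin N) ℂ) : normTr N M = (N : ℂ)⁻¹ * M.trace := rfl

theorem normTr_one [NeZero N] : normTr N 1 = 1 := by
  simp [normTr]

theorem ncDist_one [NeZero N] {σ : Type*} (M : σ → Matrix (Fin N) (Fin N) ℂ) : ncDist M 1 = 1 := by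
  simp [ncDist, normTr_one]

theorem ncDist_mul_comm {σ : Type*} (M : σ → Matrix (Fin N) (Fin N) ℂ) (P Q) :
    ncDist M (P * Q) = ncDist M (Q * P) := by
  simp [ncDist, normTr_mul_comm (FreeAlgebra.lift ℂ M P)]

theorem jointDist_inclX (A : Fin k → Matrix (Fin N) (Fin N) ℂ)
    (B : Fin l → Matrix (Fin N) (Fin N) ℂ) (u : Matrix.unitaryGroup (Fin N) ℂ) (a) :
    jointDist A (conjTuple u B) (inclX k l a) = ncDist A a := by
  rw [jointDist_eq_normTr_matEval, matEval_inclX]; rfl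

theorem jointDist_inclY (A : Fin k → Matrix (Fin N) (Fin N) ℂ)
    (B : Fin l → Matrix (Fin N) (Fin N) ℂ) (u : Matrix.unitaryGroup (Fin N) ℂ) (b) :
    jointDist A (conjTuple u B) (inclY k l b) = ncDist B b := by
  rw [jointDist_eq_normTr_matEval, matEval_inclY, normTr_mul_comm, ← mul_assoc,
    Unitary.coe_star_mul_self u, one_mul]; rfl

/-- The sandwich `x ⊗ y ↦ (X ↦ f x * X * f y)`. -/
def sandwich (f : FreeAlgebra ℂ (Fin k ⊕ Fin l) →ₐ[ℂ] Matrix (Fin N) (Fin N) ℂ) :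
    FreeAlgebra ℂ (Fin k ⊕ Fin l) ⊗[ℂ] FreeAlgebra ℂ (Fin k ⊕ Fin l) →ₗ[ℂ]
      Matrix (Fin N) (Fin N) ℂ →ₗ[ℂ] Matrix (Fin N) (Fin N) ℂ :=
  TensorProduct.lift (LinearMap.mk₂ ℂ
    (fun x y => LinearMap.mulLeft ℂ (f x) ∘ₗ LinearMap.mulRight ℂ (f y))
    (fun x x' y => by ext1 X; simp [add_mul]) (fun c x y => by ext1 X; simp)
    (fun x y y' => by ext1 X; simp [mul_add]) (fun c x y => by ext1 X; simp))

@[simp] theorem sandwich_tmul (f : FreeAlgebra ℂ (Fin k ⊕ Fin l) →ₐ[ℂ] Matrix (Fin N) (Fin N) ℂ)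
    (x y) (X : Matrix (Fin N) (Fin N) ℂ) : sandwich f (x ⊗ₜ y) X = f x * X * f y := by
  simp [sandwich, mul_assoc]

theorem sandwich_mul_left (f : FreeAlgebra ℂ (Fin k ⊕ Fin l) →ₐ[ℂ] Matrix (Fin N) (Fin N) ℂ)
    (p z) (X : Matrix (Fin N) (Fin N) ℂ) :
    sandwich f ((p ⊗ₜ 1) * z) X = f p * sandwich f z X := by
  induction z with
  | zero => simp
  | tmul x y => simp [mul_assoc]
  | add x y hx hy => simp only [mul_add, map_add, LinearMap.add_apply, hx, hy]

theorem sandwich_mul_right (f : FreeAlgebra ℂ (Fin k ⊕ Fin l) →ₐ[ℂ] Matrix (Fin N) (Fin N) ℂ)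
    (p z) (X : Matrix (Fin N) (Fin N) ℂ) :
    sandwich f (z * (1 ⊗ₜ p)) X = sandwich f z X * f p := by
  induction z with
  | zero => simp
  | tmul x y => simp [mul_assoc]
  | add x y hx hy => simp only [add_mul, map_add, LinearMap.add_apply, hx, hy]

theorem sandwich_apply_eval (f : FreeAlgebra ℂ (Fin k ⊕ Fin l) →ₐ[ℂ] Matrix (Fin N) (Fin N) ℂ)
    (P z) : sandwich f z (f P) = f (insertion P z) := by
  induction z with
  | zero => simp
  | tmul x y => simp
  | add x y hx hy => simp only [map_add, LinearMap.add_apply, hx, hy]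

/-- Summing `(x E_ij y)_ij = x_ii y_jj` over all matrix units gives `Tr x · Tr y`. -/
theorem sum_sandwich_single (f : FreeAlgebra ℂ (Fin k ⊕ Fin l) →ₐ[ℂ] Matrix (Fin N) (Fin N) ℂ)
    (z) : ∑ i, ∑ j, sandwich f z (Matrix.single i j 1) i j =
      tensorSq (Matrix.traceLinearMap (Fin N) ℂ ℂ ∘ₗ f.toLinearMap) z := by
  induction z with
  | zero => simp
  | tmul x y =>
    simp [Matrix.trace, Finset.sum_mul_sum, Matrix.mul_apply, Matrix.single_apply, ite_and]
  | add x y hx hy => simp only [map_add, LinearMap.add_apply, Matrix.add_apply,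
      Finset.sum_add_distrib, hx, hy]

theorem continuous_matEval (A : Fin k → Matrix (Fin N) (Fin N) ℂ)
    (B : Fin l → Matrix (Fin N) (Fin N) ℂ) (P) : Continuous fun u => matEval A B u P := by
  induction P using FreeAlgebra.induction with
  | grade0 r => simpa using continuous_const
  | grade1 x =>
    rcases x with i | j
    · simpa [matEval] using continuous_const
    · simp only [matEval, FreeAlgebra.lift_ι_apply, Sum.elim_inr, conjTuple]
      fun_prop
  | mul a b ha hb => simp only [map_mul]; exact ha.mul hb
  | add a b ha hb => simp only [map_add]; exact ha.add hb

theorem continuous_sandwich (A : Fin k → Matrix (Fin N) (Fin N) ℂ)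
    (B : Fin l → Matrix (Fin N) (Fin N) ℂ) (z) (X : Matrix (Fin N) (Fin N) ℂ) :
    Continuous fun u => sandwich (matEval A B u) z X := by
  induction z with
  | zero => simpa using continuous_const
  | tmul x y =>
    simp only [sandwich_tmul]
    exact ((continuous_matEval A B x).mul continuous_const).mul (continuous_matEval A B y)
  | add x y hx hy => simp only [map_add, LinearMap.add_apply]; exact hx.add hy

theorem continuous_normTr : Continuous (normTr N) :=
  continuous_const.mul (Continuous.matrix_trace continuous_id)

/-! ### Differentiation along one-parameter unitary groups and integration by parts -/

open scoped Matrix.Norms.L2Operator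

theorem hasDerivAt_expUnitary (H : selfAdjoint (Matrix (Fin N) (Fin N) ℂ)) :
    HasDerivAt (fun t : ℝ => (selfAdjoint.expUnitary (t • H) : Matrix (Fin N) (Fin N) ℂ))
      (Complex.I • (H : Matrix (Fin N) (Fin N) ℂ)) 0 := by
  have h := hasDerivAt_exp_smul_const (𝕂 := ℝ) (Complex.I • (H : Matrix (Fin N) (Fin N) ℂ)) 0
  simp only [zero_smul, NormedSpace.exp_zero, one_mul] at h
  convert! h using 2 with t
  rw [selfAdjoint.expUnitary_coe, selfAdjoint.val_smul, smul_comm]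

/-- Left translation of `u` by `exp(itH)` fixes `A` and conjugates `u B u*`, so each `Y` has
derivative `[iH, Y]`, the sandwich of `1 ⊗ Y - Y ⊗ 1` around `iH`; the Leibniz rules extend this to
all polynomials. -/
theorem hasDerivAt_matEval (A : Fin k → Matrix (Fin N) (Fin N) ℂ)
    (B : Fin l → Matrix (Fin N) (Fin N) ℂ) (H : selfAdjoint (Matrix (Fin N) (Fin N) ℂ))
    (u : Matrix.unitaryGroup (Fin N) ℂ) (P) :
    HasDerivAt (fun t : ℝ => matEval A B (selfAdjoint.expUnitary (t • H) * u) P)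
      (sandwich (matEval A B u) (dq k l P) (Complex.I • (H : Matrix (Fin N) (Fin N) ℂ))) 0 := by
  induction P using FreeAlgebra.induction with
  | grade0 r => simpa using hasDerivAt_const _ _
  | grade1 x =>
    rcases x with i | j
    · simpa [matEval] using hasDerivAt_const _ _
    · have h1 := hasDerivAt_expUnitary H
      have h2 := (h1.mul_const (conjTuple u B j)).mul h1.star
      convert! h2 using 1
      · ext t : 1
        simp [matEval, conjTuple, mul_assoc]
      · have hH : star (H : Matrix (Fin N) (Fin N) ℂ) = H := H.2
        simp [matEval, hH, sub_eq_add_neg, selfAdjoint.expUnitary_zero]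
  | mul a b ha hb =>
    simp only [map_mul, dq_mul, map_add, sandwich_mul_left, sandwich_mul_right,
      LinearMap.add_apply]
    have h := ha.mul hb
    convert! h using 1
    simp [selfAdjoint.expUnitary_zero, add_comm]
  | add a b ha hb => simp only [map_add, LinearMap.add_apply]; exact ha.add hb

theorem hasDerivAt_list_prod {α : Type*} (L : List α) {f : α → ℝ → ℂ} {f' : α → ℂ} {t : ℝ}
    (h : ∀ a, HasDerivAt (f a) (f' a) t) :
    HasDerivAt (fun x => (L.map fun a => f a x).prod) ((cuts L).map fun r =>
      (r.1.map fun a => f a t).prod * (f' r.2.1 * (r.2.2.map fun a => f a t).prod)).sum t := by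
  induction L with
  | nil => simpa [cuts] using hasDerivAt_const _ _
  | cons a L ih =>
    simp only [cuts, List.map_cons, List.prod_cons, List.sum_cons, List.map_map,
      Function.comp_def, List.map_nil, List.prod_nil, one_mul, mul_assoc, List.sum_map_mul_left]
    exact (h a).mul ih

variable (μ : Measure (Matrix.unitaryGroup (Fin N) ℂ)) [IsProbabilityMeasure μ]

theorem integrable_of_continuous {f : Matrix.unitaryGroup (Fin N) ℂ → ℂ} (hf : Continuous f) :
    Integrable f μ := by
  obtain ⟨C, hC⟩ := isCompact_univ.exists_bound_of_continuousOn hf.continuousOn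
  exact Integrable.of_bound hf.measurable.aestronglyMeasurable C
    (Eventually.of_forall fun u => hC u (Set.mem_univ _))

/-- Integration by parts on the unitary group. -/
theorem integral_deriv_eq_zero [μ.IsMulLeftInvariant]
    (H : selfAdjoint (Matrix (Fin N) (Fin N) ℂ)) {f f' : Matrix.unitaryGroup (Fin N) ℂ → ℂ}
    (hf : Continuous f) (hf' : Continuous f')
    (h : ∀ u, HasDerivAt (fun t : ℝ => f (selfAdjoint.expUnitary (t • H) * u)) (f' u) 0) :
    ∫ u, f' u ∂μ = 0 := by
  have hadd : ∀ s t : ℝ, selfAdjoint.expUnitary ((s + t) • H) =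
      selfAdjoint.expUnitary (s • H) * selfAdjoint.expUnitary (t • H) := by
    intro s t
    rw [add_smul]
    exact Commute.expUnitary_add (by
      simp only [selfAdjoint.val_smul]
      exact ((Commute.refl _).smul_left _).smul_right _)
  -- The group law reduces the derivative at time `t` to the derivative at time `0` from the base
  -- point `exp(itH) u`.
  have hd : ∀ u (t : ℝ), HasDerivAt (fun t : ℝ => f (selfAdjoint.expUnitary (t • H) * u))
      (f' (selfAdjoint.expUnitary (t • H) * u)) t := by
    intro u t
    have h1 := h (selfAdjoint.expUnitary (t • H) * u)
    rw [← sub_self t] at h1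
    have h2 := h1.comp_sub_const t t
    convert! h2 using 2 with s
    rw [← mul_assoc, ← hadd, sub_add_cancel]
  obtain ⟨C, hC⟩ := isCompact_univ.exists_bound_of_continuousOn hf'.continuousOn
  have key := (hasDerivAt_integral_of_dominated_loc_of_deriv_le (μ := μ) (𝕜 := ℝ)
    (F := fun t u => f (selfAdjoint.expUnitary (t • H) * u))
    (F' := fun t u => f' (selfAdjoint.expUnitary (t • H) * u)) (x₀ := 0) (s := Set.univ)
    (bound := fun _ => C) univ_mem
    (Eventually.of_forall fun t =>
      (hf.comp (continuous_const.mul continuous_id)).measurable.aestronglyMeasurable)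
    (integrable_of_continuous μ (hf.comp (continuous_const.mul continuous_id)))
    (hf'.comp (continuous_const.mul continuous_id)).measurable.aestronglyMeasurable
    (Eventually.of_forall fun u t _ => hC _ (Set.mem_univ _)) (integrable_const C)
    (Eventually.of_forall fun u t _ => hd u t)).2
  -- By left invariance the integral is constant in `t`, so its derivative, the integral of `f'`, is
  -- zero.
  simp only [integral_mul_left_eq_self (μ := μ) f, integral_mul_left_eq_self (μ := μ) f'] at key
  exact key.unique (hasDerivAt_const _ _)

variable (A : Fin k → Matrix (Fin N) (Fin N) ℂ) (B : Fin l → Matrix (Fin N) (Fin N) ℂ)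

/-- The derivative of `u ↦ P(A, u B u*)ᵢⱼ ∏ tr Q(A, u B u*)` in the direction `X`. -/
def momentDeriv (P : FreeAlgebra ℂ (Fin k ⊕ Fin l)) (Qs : List (FreeAlgebra ℂ (Fin k ⊕ Fin l)))
    (i j : Fin N) (X : Matrix (Fin N) (Fin N) ℂ) (u : Matrix.unitaryGroup (Fin N) ℂ) : ℂ :=
  sandwich (matEval A B u) (dq k l P) X i j *
      (Qs.map fun Q => normTr N (matEval A B u Q)).prod +
    matEval A B u P i j * ((cuts Qs).map fun t =>
      (t.1.map fun Q => normTr N (matEval A B u Q)).prod *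
        (normTr N (sandwich (matEval A B u) (dq k l t.2.1) X) *
          (t.2.2.map fun Q => normTr N (matEval A B u Q)).prod)).sum

theorem continuous_prod_normTr (Qs : List (FreeAlgebra ℂ (Fin k ⊕ Fin l))) :
    Continuous fun u => (Qs.map fun Q => normTr N (matEval A B u Q)).prod :=
  continuous_list_prod _ fun Q _ => continuous_normTr.comp (continuous_matEval A B Q)

theorem continuous_momentDeriv (P Qs i j X) : Continuous (momentDeriv A B P Qs i j X) := by
  refine (((continuous_sandwich A B _ X).matrix_elem i j).mul
    (continuous_prod_normTr A B Qs)).add (((continuous_matEval A B P).matrix_elem i j).mul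
    (continuous_list_sum _ fun t _ => (continuous_prod_normTr A B _).mul
      ((continuous_normTr.comp (continuous_sandwich A B _ X)).mul (continuous_prod_normTr A B _))))

theorem hasDerivAt_moment (P Qs) (i j : Fin N) (H : selfAdjoint (Matrix (Fin N) (Fin N) ℂ)) (u) :
    HasDerivAt (fun t : ℝ => matEval A B (selfAdjoint.expUnitary (t • H) * u) P i j *
      (Qs.map fun Q => normTr N (matEval A B (selfAdjoint.expUnitary (t • H) * u) Q)).prod)
      (momentDeriv A B P Qs i j (Complex.I • (H : Matrix (Fin N) (Fin N) ℂ)) u) 0 := by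
  have hlin : ∀ (L : Matrix (Fin N) (Fin N) ℂ →ₗ[ℂ] ℂ) (Q), HasDerivAt
      (fun t : ℝ => L (matEval A B (selfAdjoint.expUnitary (t • H) * u) Q))
      (L (sandwich (matEval A B u) (dq k l Q) (Complex.I • (H : Matrix (Fin N) (Fin N) ℂ)))) 0 := by
    intro L Q
    exact ((L.restrictScalars ℝ).toContinuousLinearMap.hasFDerivAt.comp_hasDerivAt (0 : ℝ)
      (hasDerivAt_matEval A B H u Q) :)
  have h1 := hlin (Matrix.entryLinearMap ℂ ℂ i j) P
  have h2 := hasDerivAt_list_prod Qs (fun Q => hlin (normTr N) Q)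
  convert! h1.mul h2 using 1
  simp [momentDeriv, selfAdjoint.expUnitary_zero, -map_smul]

theorem momentDeriv_add (P Qs i j X X' u) : momentDeriv A B P Qs i j (X + X') u =
    momentDeriv A B P Qs i j X u + momentDeriv A B P Qs i j X' u := by
  simp only [momentDeriv, map_add, Matrix.add_apply, add_mul, mul_add, List.sum_map_add]
  ring

theorem momentDeriv_smul (P Qs i j X u) (c : ℂ) : momentDeriv A B P Qs i j (c • X) u =
    c * momentDeriv A B P Qs i j X u := by
  simp only [momentDeriv, map_smul, Matrix.smul_apply, smul_eq_mul, mul_add, mul_assoc,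
    ← List.sum_map_mul_left]
  congr 3
  funext t
  ring

/-- Integration by parts only covers the directions `iH` with `H` self-adjoint. The expression is
complex linear in `X`, and every matrix is a complex combination of two such directions. -/
theorem integral_momentDeriv [μ.IsMulLeftInvariant] (P Qs i j X) :
    ∫ u, momentDeriv A B P Qs i j X u ∂μ = 0 := by
  have hI : ∀ H : selfAdjoint (Matrix (Fin N) (Fin N) ℂ), ∫ u, momentDeriv A B P Qs i j
      (Complex.I • (H : Matrix (Fin N) (Fin N) ℂ)) u ∂μ = 0 := fun H =>
    integral_deriv_eq_zero μ H (((continuous_matEval A B P).matrix_elem i j).mul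
      (continuous_prod_normTr A B Qs)) (continuous_momentDeriv A B P Qs i j _)
      (hasDerivAt_moment A B P Qs i j H)
  have hX : X = (-Complex.I) • (Complex.I • (realPart X : Matrix (Fin N) (Fin N) ℂ)) +
      Complex.I • (imaginaryPart X : Matrix (Fin N) (Fin N) ℂ) := by
    rw [smul_smul, neg_mul, Complex.I_mul_I, neg_neg, one_smul, realPart_add_I_smul_imaginaryPart]
  rw [hX]
  simp only [momentDeriv_add, momentDeriv_smul (c := -Complex.I)]
  rw [integral_add ((integrable_of_continuous μ (continuous_momentDeriv A B P Qs i j _)).const_mul _)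
    (integrable_of_continuous μ (continuous_momentDeriv A B P Qs i j _)), integral_const_mul,
    hI, hI]
  simp

/-- With `X = E_ij` in the entry `(i, j)`, the derivative of `P` becomes a product of two traces. In
the other terms linearity reassembles `P` from its entries, which inserts it into `∂Q`. -/
theorem sum_momentDeriv_single (P Qs) (u) :
    ∑ i, ∑ j, momentDeriv A B P Qs i j (Matrix.single i j 1) u =
      tensorSq (Matrix.traceLinearMap (Fin N) ℂ ℂ ∘ₗ (matEval A B u).toLinearMap) (dq k l P) *
        (Qs.map fun Q => normTr N (matEval A B u Q)).prod +
      ((cuts Qs).map fun t => (t.1.map fun Q => normTr N (matEval A B u Q)).prod *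
        (normTr N (matEval A B u (insertion P (dq k l t.2.1))) *
          (t.2.2.map fun Q => normTr N (matEval A B u Q)).prod)).sum := by
  simp only [momentDeriv, Finset.sum_add_distrib]
  congr 1
  · simp only [← Finset.sum_mul]
    rw [sum_sandwich_single]
  · let Λ : Matrix (Fin N) (Fin N) ℂ →ₗ[ℂ] ℂ :=
      { toFun := fun X => ((cuts Qs).map fun t =>
          (t.1.map fun Q => normTr N (matEval A B u Q)).prod *
          (normTr N (sandwich (matEval A B u) (dq k l t.2.1) X) *
            (t.2.2.map fun Q => normTr N (matEval A B u Q)).prod)).sum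
        map_add' := fun X X' => by
          simp only [map_add, add_mul, mul_add, List.sum_map_add]
        map_smul' := fun c X => by
          simp only [map_smul, smul_eq_mul, RingHom.id_apply, ← List.sum_map_mul_left]
          congr 1
          refine List.map_congr_left fun t _ => ?_
          ring }
    have h : Λ (matEval A B u P) = ∑ i, ∑ j, matEval A B u P i j * Λ (Matrix.single i j 1) := by
      conv_lhs => rw [Matrix.matrix_eq_sum_single (matEval A B u P)]
      simp only [map_sum]
      refine Finset.sum_congr rfl fun i _ => Finset.sum_congr rfl fun j _ => ?_
      rw [← smul_eq_mul, ← map_smul, Matrix.smul_single, smul_eq_mul, mul_one]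
    refine h.symm.trans ?_
    simp only [Λ, LinearMap.coe_mk, AddHom.coe_mk, sandwich_apply_eval]

/-- The distribution of `(A, u B u*)` as a continuous function of `u`. -/
def distFun : FreeAlgebra ℂ (Fin k ⊕ Fin l) →ₗ[ℂ] C(Matrix.unitaryGroup (Fin N) ℂ, ℂ) where
  toFun P := ⟨fun u => jointDist A (conjTuple u B) P, continuous_jointDist_conjTuple A B P⟩
  map_add' P Q := by ext u; simp
  map_smul' c P := by ext u; simp

@[simp] theorem distFun_apply (P u) : distFun A B P u = normTr N (matEval A B u P) := rfl

/-- Integration as a linear functional on continuous functions. -/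
def integralFunctional : C(Matrix.unitaryGroup (Fin N) ℂ, ℂ) →ₗ[ℂ] ℂ where
  toFun f := ∫ u, f u ∂μ
  map_add' f g := integral_add (integrable_of_continuous μ f.continuous)
    (integrable_of_continuous μ g.continuous)
  map_smul' c _ := integral_const_mul c _

theorem coe_list_prod (Qs : List (FreeAlgebra ℂ (Fin k ⊕ Fin l))) (u) :
    (Qs.map (distFun A B)).prod u = (Qs.map fun Q => normTr N (matEval A B u Q)).prod := by
  induction Qs with
  | nil => rfl
  | cons Q Qs ih => simp [ih]

/-- The parameter `N⁻²` comes from normalization: the split term carries two unnormalized traces,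
equal to `N²` times normalized ones, while the insertion terms carry no such factor. -/
theorem haar_loopEq [NeZero N] [μ.IsMulLeftInvariant] :
    LoopEq (ncDist A) (ncDist B) (((N : ℂ) ^ 2)⁻¹)
      fun Qs => integralFunctional μ (Qs.map (distFun A B)).prod := by
  have hN : (N : ℂ) ≠ 0 := Nat.cast_ne_zero.2 (NeZero.ne N)
  refine loopEq_of_dq (distFun A B) (integralFunctional μ) _ ?_ ?_ (fun a => ?_) (fun b => ?_)
    (fun a P => ?_) (fun b P => ?_) fun P Qs => ?_
  · simp [integralFunctional]
  · ext u; simp [normTr_one]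
  · ext u; exact jointDist_inclX A B u a
  · ext u; exact jointDist_inclY A B u b
  · ext u; simp [normTr_mul_comm (matEval A B u (inclX k l a))]
  · ext u; simp [normTr_mul_comm (matEval A B u (inclY k l b))]
  · have hts : ∀ (z) (u), tensorSq (distFun A B) z u = ((N : ℂ) ^ 2)⁻¹ *
        tensorSq (Matrix.traceLinearMap (Fin N) ℂ ℂ ∘ₗ (matEval A B u).toLinearMap) z := by
      intro z u
      induction z with
      | zero => simp
      | tmul x y => simp [normTr_apply]; ring
      | add x y hx hy => simp only [map_add, ContinuousMap.add_apply, hx, hy, mul_add]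
    have hsum : ∀ (L : List (List (FreeAlgebra ℂ (Fin k ⊕ Fin l)) × FreeAlgebra ℂ (Fin k ⊕ Fin l) ×
        List (FreeAlgebra ℂ (Fin k ⊕ Fin l)))) (u),
        (L.map fun t => (t.1.map (distFun A B)).prod * (distFun A B (insertion P (dq k l t.2.1)) *
          (t.2.2.map (distFun A B)).prod)).sum u =
        (L.map fun t => (t.1.map fun Q => normTr N (matEval A B u Q)).prod *
        (normTr N (matEval A B u (insertion P (dq k l t.2.1))) *
          (t.2.2.map fun Q => normTr N (matEval A B u Q)).prod)).sum := by
      intro L u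
      induction L with
      | nil => rfl
      | cons t L ih => simp [ih, coe_list_prod]
    have hlist : ((cuts Qs).map fun t => integralFunctional μ ((t.1.map (distFun A B)).prod *
        (distFun A B (insertion P (dq k l t.2.1)) * (t.2.2.map (distFun A B)).prod))).sum =
        integralFunctional μ ((cuts Qs).map fun t => (t.1.map (distFun A B)).prod *
          (distFun A B (insertion P (dq k l t.2.1)) * (t.2.2.map (distFun A B)).prod)).sum := by
      rw [map_list_sum, List.map_map]; rfl
    rw [hlist, ← smul_eq_mul (_ ^ 2)⁻¹, ← map_smul, ← map_add]
    change ∫ u, _ ∂μ = 0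
    have hpt : ∀ u, (tensorSq (distFun A B) (dq k l P) * (Qs.map (distFun A B)).prod +
        ((N : ℂ) ^ 2)⁻¹ • ((cuts Qs).map fun t => (t.1.map (distFun A B)).prod *
          (distFun A B (insertion P (dq k l t.2.1)) * (t.2.2.map (distFun A B)).prod)).sum) u =
        ((N : ℂ) ^ 2)⁻¹ * ∑ i, ∑ j, momentDeriv A B P Qs i j (Matrix.single i j 1) u := by
      intro u
      rw [sum_momentDeriv_single, ContinuousMap.add_apply, ContinuousMap.mul_apply,
        ContinuousMap.smul_apply, hts, hsum, coe_list_prod, smul_eq_mul]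
      ring
    simp only [hpt]
    rw [integral_const_mul, integral_finsetSum]
    · rw [Finset.sum_eq_zero, mul_zero]
      intro i _
      rw [integral_finsetSum]
      · exact Finset.sum_eq_zero fun j _ => integral_momentDeriv μ A B P Qs i j _
      · exact fun j _ => integrable_of_continuous μ (continuous_momentDeriv A B P Qs i j _)
    · exact fun i _ => integrable_finsetSum _ fun j _ =>
        integrable_of_continuous μ (continuous_momentDeriv A B P Qs i j _)

end Haar

/-! ### Asymptotic freeness up to order `O(N⁻²)` -/

section Main

variable {Ω : Type*} [MeasurableSpace Ω] (ℙ : Measure Ω) [IsProbabilityMeasure ℙ] {k l : ℕ}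

theorem expectedDist_eq {N : ℕ} {U : Ω → Matrix.unitaryGroup (Fin N) ℂ} (hU : Measurable U)
    (A : Fin k → Matrix (Fin N) (Fin N) ℂ) (B : Fin l → Matrix (Fin N) (Fin N) ℂ) (P) :
    haveI := Measure.isProbabilityMeasure_map (μ := ℙ) hU.aemeasurable
    expectedDist ℙ hU A B P = integralFunctional (ℙ.map U) (distFun A B P) :=
  (integral_map hU.aemeasurable
    (distFun A B P).continuous.measurable.aestronglyMeasurable).symm

theorem expectedDist_inclX {N : ℕ} {U : Ω → Matrix.unitaryGroup (Fin N) ℂ} (hU : Measurable U)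
    (A : Fin k → Matrix (Fin N) (Fin N) ℂ) (B : Fin l → Matrix (Fin N) (Fin N) ℂ) (a) :
    expectedDist ℙ hU A B (inclX k l a) = ncDist A a := by
  simp [expectedDist, jointDist_inclX]

theorem expectedDist_inclY {N : ℕ} {U : Ω → Matrix.unitaryGroup (Fin N) ℂ} (hU : Measurable U)
    (A : Fin k → Matrix (Fin N) (Fin N) ℂ) (B : Fin l → Matrix (Fin N) (Fin N) ℂ) (b) :
    expectedDist ℙ hU A B (inclY k l b) = ncDist B b := by
  simp [expectedDist, jointDist_inclY]

theorem expectedDist_one {N : ℕ} [NeZero N] {U : Ω → Matrix.unitaryGroup (Fin N) ℂ}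
    (hU : Measurable U) (A : Fin k → Matrix (Fin N) (Fin N) ℂ)
    (B : Fin l → Matrix (Fin N) (Fin N) ℂ) : expectedDist ℙ hU A B 1 = 1 := by
  rw [← map_one (inclX k l), expectedDist_inclX, ncDist_one]

theorem isFreeProduct_ncDist {N : ℕ} [NeZero N] (A : Fin k → Matrix (Fin N) (Fin N) ℂ)
    (B : Fin l → Matrix (Fin N) (Fin N) ℂ) :
    IsFreeProduct (ncDist A) (ncDist B) (freeProduct (ncDist A) (ncDist B)) :=
  isFreeProduct_freeProduct (ncDist_one A) (ncDist_one B)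

theorem expectedDist_eq_freeProduct {N : ℕ} [NeZero N] {U : Ω → Matrix.unitaryGroup (Fin N) ℂ}
    (hU : Measurable U) (A : Fin k → Matrix (Fin N) (Fin N) ℂ)
    (B : Fin l → Matrix (Fin N) (Fin N) ℂ) (c : Fin 2) {x} (hx : x ∈ subalgXY k l c) :
    expectedDist ℙ hU A B x = freeProduct (ncDist A) (ncDist B) x := by
  have h := isFreeProduct_ncDist A B
  fin_cases c
  · obtain ⟨a, rfl⟩ := hx
    exact (expectedDist_inclX ℙ hU A B a).trans (h.1 a).symm
  · obtain ⟨b, rfl⟩ := hx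
    exact (expectedDist_inclY ℙ hU A B b).trans (h.2.1 b).symm

theorem BoundedInDist.isBigO_one {k : ℕ} {A : ∀ N : ℕ+, Fin k → Matrix (Fin N) (Fin N) ℂ}
    (hA : BoundedInDist A) (P) : (fun N => ncDist (A N) P) =O[atTop] fun _ => (1 : ℝ) := by
  obtain ⟨C, hC⟩ := hA P
  exact IsBigO.of_bound C (Eventually.of_forall fun N => by simpa using hC ⟨N, rfl⟩)

theorem tendsto_inv_sq : Tendsto (fun N : ℕ+ => (((N : ℕ) : ℂ) ^ 2)⁻¹) atTop (𝓝 0) := by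
  have h : Tendsto (fun n : ℕ => ((n : ℂ) ^ 2)⁻¹) atTop (𝓝 0) := by
    have := (tendsto_inv_atTop_nhds_zero_nat (𝕜 := ℂ)).pow 2
    simpa using this
  exact h.comp tendsto_PNat_val_atTop_atTop

instance neZero_pnat (N : ℕ+) : NeZero (N : ℕ) := ⟨N.ne_zero⟩

variable {A : ∀ N : ℕ+, Fin k → Matrix (Fin N) (Fin N) ℂ}
    {B : ∀ N : ℕ+, Fin l → Matrix (Fin N) (Fin N) ℂ}
    {U : ∀ N : ℕ+, Ω → Matrix.unitaryGroup (Fin N) ℂ}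

theorem expectedDist_sub_freeProduct_isBigO (hA : BoundedInDist A) (hB : BoundedInDist B)
    (hU : ∀ N, Measurable (U N)) (hHaar : ∀ N, (ℙ.map (U N)).IsHaarMeasure) (P) :
    (fun N : ℕ+ => expectedDist ℙ (hU N) (A N) (B N) P -
      freeProduct (ncDist (A N)) (ncDist (B N)) P) =O[atTop]
        fun N : ℕ+ => (((N : ℕ) : ℂ) ^ 2)⁻¹ := by
  have hP : P ∈ Submodule.span ℂ (Set.range (wordEval (k := k) (l := l))) := by
    rw [span_range_wordEval]; trivial
  induction hP using Submodule.span_induction with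
  | zero => simpa using isBigO_zero _ _
  | add P Q _ _ hP hQ =>
    refine (hP.add hQ).congr_left fun N => ?_
    rw [map_add, map_add]; ring
  | smul c P _ hP =>
    refine (hP.const_mul_left c).congr_left fun N => ?_
    rw [map_smul, map_smul, smul_eq_mul, smul_eq_mul]; ring
  | mem P hP =>
    obtain ⟨w, rfl⟩ := hP
    -- Configurations consist of non-empty words, so the unit is treated separately.
    by_cases hw : w = []
    · subst hw
      have h1 : ∀ N, freeProduct (ncDist (A N)) (ncDist (B N)) 1 = 1 := fun N =>
        (isFreeProduct_ncDist (A N) (B N)).apply_one (ncDist_one _)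
      simpa [expectedDist_one, h1] using isBigO_zero _ _
    · have hp : ∀ N, IsProbabilityMeasure (ℙ.map (U N)) := fun N =>
        Measure.isProbabilityMeasure_map (hU N).aemeasurable
      have h := LoopEq.sub_isBigO (n := w.length) (Ws := [w]) tendsto_inv_sq
        (fun N => haar_loopEq (ℙ.map (U N)) (A N) (B N))
        (fun N => (isFreeProduct_ncDist (A N) (B N)).loopEq (ncDist_one _) (ncDist_mul_comm _)
          (ncDist_mul_comm _)) hA.isBigO_one hB.isBigO_one (by simp [configs, size, hw])
      simpa [expectedDist_eq] using h

/-- The estimate for a fixed polynomial does not apply directly, because the centering constants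
depend on `N`. The factors are expanded one at a time, with the processed ones collected in `Q`;
each constant is bounded, being a moment of `A` or `B` alone. -/
theorem expectedDist_centered_isBigO (hA : BoundedInDist A) (hB : BoundedInDist B)
    (hU : ∀ N, Measurable (U N)) (hHaar : ∀ N, (ℙ.map (U N)).IsHaarMeasure)
    (L : List (FreeAlgebra ℂ (Fin k ⊕ Fin l))) (hL : ∀ x ∈ L, ∃ c, x ∈ subalgXY k l c) (Q) :
    (fun N : ℕ+ => expectedDist ℙ (hU N) (A N) (B N) (Q * (L.map fun x => x - algebraMap ℂ _
        (expectedDist ℙ (hU N) (A N) (B N) x)).prod) -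
      freeProduct (ncDist (A N)) (ncDist (B N)) (Q * (L.map fun x => x - algebraMap ℂ _
        (expectedDist ℙ (hU N) (A N) (B N) x)).prod)) =O[atTop]
        fun N : ℕ+ => (((N : ℕ) : ℂ) ^ 2)⁻¹ := by
  induction L generalizing Q with
  | nil => simpa using expectedDist_sub_freeProduct_isBigO ℙ hA hB hU hHaar Q
  | cons x L ih =>
    have ih' := ih fun y hy => hL y (by simp [hy])
    have hx : (fun N : ℕ+ => expectedDist ℙ (hU N) (A N) (B N) x) =O[atTop]
        fun _ => (1 : ℝ) := by
      obtain ⟨c, hc⟩ := hL x (by simp)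
      fin_cases c
      · obtain ⟨a, rfl⟩ := hc
        exact (hA.isBigO_one a).congr_left fun N => (expectedDist_inclX ℙ (hU N) _ _ a).symm
      · obtain ⟨b, rfl⟩ := hc
        exact (hB.isBigO_one b).congr_left fun N => (expectedDist_inclY ℙ (hU N) _ _ b).symm
    have h2 := (ih' (Q * x)).sub (bounded_mul_isBigO hx (ih' Q).norm_right).of_norm_right
    refine h2.congr_left fun N => ?_
    simp only [List.map_cons, List.prod_cons, Algebra.algebraMap_eq_smul_one, sub_mul, mul_sub,
      smul_mul_assoc, mul_smul_comm, one_mul, map_sub, map_smul, smul_eq_mul, mul_assoc]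
    ring

theorem isFreeUpToOrderSq_expectedDist (hA : BoundedInDist A) (hB : BoundedInDist B)
    (hU : ∀ N, Measurable (U N)) (hHaar : ∀ N, (ℙ.map (U N)).IsHaarMeasure) :
    IsFreeUpToOrderSq (subalgXY k l) atTop (fun N : ℕ+ => (N : ℝ)⁻¹)
      (fun N : ℕ+ => expectedDist ℙ (hU N) (A N) (B N)) := by
  refine ⟨fun N => expectedDist_one ℙ (hU N) _ _, fun n a ha => ?_⟩
  have hmem : ∀ x ∈ List.ofFn a, ∃ c, x ∈ subalgXY k l c := by
    intro x hx
    obtain ⟨j, rfl⟩ := (List.mem_ofFn' _ _).1 hx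
    obtain ⟨i, -, hi⟩ := ha
    exact ⟨i j, hi j⟩
  have h := expectedDist_centered_isBigO ℙ hA hB hU hHaar (List.ofFn a) hmem 1
  have hnorm : (fun N : ℕ+ => (((N : ℕ) : ℂ) ^ 2)⁻¹) =O[atTop] fun N : ℕ+ => ((N : ℝ)⁻¹) ^ 2 :=
    IsBigO.of_bound 1 (Eventually.of_forall fun N => by simp)
  refine (h.trans hnorm).congr_left fun N => ?_
  rw [List.map_ofFn, one_mul]
  obtain ⟨i, hi, hai⟩ := ha
  have hfree := isFreeProduct_ncDist (A N) (B N)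
  -- Both functionals agree on the two subalgebras, so the factors are also centered for the free
  -- product, whose value on the alternating product is exactly zero.
  rw [hfree.2.2 n _ ⟨i, hi, fun j => ?_⟩ fun j => ?_, sub_zero]
  · rfl
  · exact sub_algebraMap_mem (hai j) _
  · simp only [Function.comp_apply]
    rw [expectedDist_eq_freeProduct ℙ (hU N) _ _ (i j) (hai j)]
    exact apply_sub_algebraMap (hfree.apply_one (ncDist_one _)) _

end Main

end AsympFree

end

theorem theorem3p1 {Ω : Type*} [MeasurableSpace Ω] (ℙ : Measure Ω) [IsProbabilityMeasure ℙ]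
    (k l : ℕ)
    (A : ∀ N : ℕ+, Fin k → Matrix (Fin N) (Fin N) ℂ)
    (B : ∀ N : ℕ+, Fin l → Matrix (Fin N) (Fin N) ℂ)
    (hA : AsympFree.BoundedInDist A) (hB : AsympFree.BoundedInDist B)
    (U : ∀ N : ℕ+, Ω → Matrix.unitaryGroup (Fin N) ℂ)
    (hU : ∀ N, Measurable (U N))
    (hHaar : ∀ N, (ℙ.map (U N)).IsHaarMeasure) :
    -- the free products exist and are unique
    (∀ N : ℕ+, ∀ τ : FreeAlgebra ℂ (Fin k ⊕ Fin l) →ₗ[ℂ] ℂ,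
      AsympFree.IsFreeProduct (AsympFree.ncDist (A N)) (AsympFree.ncDist (B N)) τ ↔
        τ = AsympFree.freeProduct (AsympFree.ncDist (A N)) (AsympFree.ncDist (B N))) ∧
    (∀ P : FreeAlgebra ℂ (Fin k ⊕ Fin l),
      (fun N : ℕ+ => AsympFree.expectedDist ℙ (hU N) (A N) (B N) P -
          AsympFree.freeProduct (AsympFree.ncDist (A N)) (AsympFree.ncDist (B N)) P)
        =O[atTop] fun N : ℕ+ => (N : ℝ) ^ (-2 : ℤ)) ∧
    AsympFree.IsFreeUpToOrderSq (AsympFree.subalgXY k l) atTop (fun N : ℕ+ => (N : ℝ)⁻¹)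
      (fun N : ℕ+ => AsympFree.expectedDist ℙ (hU N) (A N) (B N)) := by
  refine ⟨fun N τ => ⟨fun h => ?_, ?_⟩, fun P => ?_,
    AsympFree.isFreeUpToOrderSq_expectedDist ℙ hA hB hU hHaar⟩
  · exact h.unique (AsympFree.isFreeProduct_ncDist (A N) (B N)) (AsympFree.ncDist_one _)
  · rintro rfl
    exact AsympFree.isFreeProduct_ncDist (A N) (B N)
  · refine (AsympFree.expectedDist_sub_freeProduct_isBigO ℙ hA hB hU hHaar P).trans ?_
    exact IsBigO.of_bound 1 (Eventually.of_forall fun N => by simp [zpow_neg])
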